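/- Let $c\in(1,9/8)$. For $x\in\mathbb R^3$ put $|x|_c=\big(|x_1|^c+|x_2|^c+|x_3|^c\big)^{1/c}$, and let $\mathbb S_c^2=\{x\in\mathbb R^3:|x|_c=1\}$. For a positive integer $\lambda$ put $$\mathbf S_c^3(\lambda)=\{x\in\mathbb Z^3:\lfloor|x_1|^c\rfloor+\lfloor|x_2|^c\rfloor+\lfloor|x_3|^c\rfloor=\lambda\},\qquad r_c(\lambda)=\#\mathbf S_c^3(\lambda),\qquad \mathbf P_c^3(\lambda)=\{\lambda^{-1/c}x:x\in\mathbf S_c^3(\lambda)\}.$$ There is a unique Borel measure $\mu_c$ on $\mathbb S_c^2$ such that $$\int_{\mathbb R^3}f(x)\,dx=\int_0^\infty r^2\int_{\mathbb S_c^2}f(ry)\,d\mu_c(y)\,dr\qquad\text{for every Borel } f:\mathbb R^3\to[0,\infty],$$ its total mass is $$\mu_c(\mathbb S_c^2)=\frac{8\,\Gamma(1/c)^3}{c^2\,\Gamma(3/c)},$$ and, with $\nu_c=\mu_c/\mu_c(\mathbb S_c^2)$ the probability measure obtained by normalizing $\mu_c$, for every $\phi\in C^\infty(\mathbb R^3)$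 (complex-valued) the function $\phi$ is $\nu_c$-integrable on $\mathbb S_c^2$ and $$\frac1{r_c(\lambda)}\sum_{x\in\mathbf P_c^3(\lambda)}\phi(x)\;\longrightarrow\;\int_{\mathbb S_c^2}\phi(x)\,d\nu_c(x)\qquad\text{as }\lambda\to\infty .$$ -/

import Mathlib

open MeasureTheory Filter Topology Set
open scoped ENNReal ContDiff

/-- The norm `|x|_c = (∑ |x_i|^c)^(1/c)` on `ℝ³`. -/
noncomputable def cNorm (c : ℝ) (x : Fin 3 → ℝ) : ℝ :=
  (∑ i, |x i| ^ c) ^ (1 / c)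

/-- The unit sphere `𝕊_c² = {x ∈ ℝ³ : |x|_c = 1}`. -/
def cSphere (c : ℝ) : Set (Fin 3 → ℝ) :=
  {x | cNorm c x = 1}

/-- The arithmetic sphere
`S_c³(N) = {x ∈ ℤ³ : ⌊|x₁|^c⌋ + ⌊|x₂|^c⌋ + ⌊|x₃|^c⌋ = N}`. -/
def arithSphere (c : ℝ) (N : ℕ) : Set (Fin 3 → ℤ) :=
  {x | ∑ i, ⌊|(x i : ℝ)| ^ c⌋ = (N : ℤ)}

/-- Arithmetic spheres are finite, so that the cardinality and the sum over the projected points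
are the genuine ones. -/
theorem arithSphere_finite {c : ℝ} (hc : 1 ≤ c) (N : ℕ) : (arithSphere c N).Finite := by
  refine (Set.finite_Icc (fun _ : Fin 3 => -((N : ℤ) + 1)) (fun _ => (N : ℤ) + 1)).subset ?_
  intro x hx
  have hx' : ∑ i, ⌊|(x i : ℝ)| ^ c⌋ = (N : ℤ) := hx
  have key : ∀ i, |x i| ≤ (N : ℤ) + 1 := by
    intro i
    have h1 : ⌊|(x i : ℝ)| ^ c⌋ ≤ (N : ℤ) := by
      rw [← hx']
      exact Finset.single_le_sum
        (f := fun i => ⌊|(x i : ℝ)| ^ c⌋) (fun j _ => Int.floor_nonneg.2 (by positivity))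
        (Finset.mem_univ i)
    have h2 : |(x i : ℝ)| ^ c < (N : ℝ) + 1 := by
      have := Int.lt_floor_add_one (|(x i : ℝ)| ^ c)
      have h3 : ((⌊|(x i : ℝ)| ^ c⌋ : ℤ) : ℝ) ≤ (N : ℝ) := by exact_mod_cast h1
      linarith
    have h4 : |(x i : ℝ)| ≤ (N : ℝ) + 1 := by
      rcases le_total 1 (|(x i : ℝ)|) with h | h
      · exact (Real.self_le_rpow_of_one_le h hc).trans h2.le
      · have : (0 : ℝ) ≤ N := Nat.cast_nonneg N
        linarith
    exact_mod_cast h4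
  exact ⟨fun i => (abs_le.1 (key i)).1, fun i => (abs_le.1 (key i)).2⟩

/-- The projected points `P_c³(N) = {N^(-1/c) x : x ∈ S_c³(N)}`. -/
def projPoints (c : ℝ) (N : ℕ) : Set (Fin 3 → ℝ) :=
  (fun x : Fin 3 → ℤ => fun i => (N : ℝ) ^ (-1 / c) * (x i : ℝ)) '' arithSphere c N

theorem projPoints_finite {c : ℝ} (hc : 1 ≤ c) (N : ℕ) : (projPoints c N).Finite :=
  (arithSphere_finite hc N).image _

/-- `r_c(N) = #S_c³(N)`. -/
noncomputable def latticeCount (c : ℝ) (N : ℕ) : ℕ :=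
  (arithSphere c N).ncard

/-- `μ` is a Borel measure on `𝕊_c²` giving the polar decomposition of Lebesgue measure on `ℝ³`:
`∫ f(x) dx = ∫₀^∞ r² ∫ f(r y) dμ(y) dr` for every Borel `f ≥ 0`. -/
def IsPolarMeasure (c : ℝ) (μ : Measure (cSphere c)) : Prop :=
  ∀ f : (Fin 3 → ℝ) → ℝ≥0∞, Measurable f →
    ∫⁻ x, f x = ∫⁻ r in Ioi (0 : ℝ),
      ENNReal.ofReal (r ^ 2) * ∫⁻ y : cSphere c, f (r • (y : Fin 3 → ℝ)) ∂μ

/-- The normalization `μ / μ(𝕊_c²)` of a measure on `𝕊_c²`. -/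
noncomputable def normalized {c : ℝ} (μ : Measure (cSphere c)) : Measure (cSphere c) :=
  (μ univ)⁻¹ • μ

/-! Write `a = 1/c`, so `8/9 < a < 1`. Attach to a lattice point `x` the vector with coordinates
`sign(x_i) ⌊|x_i|^c⌋ / N`. It lies within `1/N` of the image of the projected point under the odd
extension of `t ↦ t^c` in each coordinate, so by uniform continuity and Weierstrass approximation it
suffices to average monomials in these coordinates (`IsPolarMeasure.tendsto_sphereAvg`).

A monomial with an odd exponent averages to zero on both sides by reflection. For even exponents
`k`, the sum over the arithmetic sphere is the coefficient of `z^N` in a product of three series `∑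
m^(k_i) r(m) z^m`, where `r(m)` counts the integers `x` with `⌊|x|^c⌋ = m`. Such `x` satisfy `m^a ≤
|x| < (m+1)^a`, so `r(m)` should behave like `2((m+1)^a - m^a)`. With this replacement the
coefficient is a convolution of power-like sequences; Chu–Vandermonde gives the main term, of size
`N^(K+3a-1)` with `K = ∑ k_i`, as a quotient of Gamma values (`tendsto_coeff_rpowIncr`). The same
quotient gives the moments of the polar measure, found by integrating `∏ |x_i|^(s_i) exp(-|x_i|^c)`
both as a product and in polar coordinates (`IsPolarMeasure.lintegral_moment`).

The replacement error is a sum of trilinear forms. Each is bounded by the sup norm of one Fourier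
transform, `O(N^(k_i+1-a/4))`, times two `ℓ²` norms, `O(N^(k_j+a/2))` (`abs_coeff_mul_mul_le`). The
total `N^(K+1+3a/4)` is smaller than the main term exactly when `a > 8/9`, that is `c < 9/8`.

The sup norm bound rests on the fact that `r(m)` minus its model is, up to a correction at `m = 0`,
twice a difference of consecutive sawtooth values at `-m^a`. The sawtooth is sandwiched between
difference quotients of the periodic second Bernoulli polynomial, whose Fourier series converges
absolutely, and each frequency is handled by van der Corput's second derivative test
(`norm_sum_sawtooth_le`). -/

/-! ### Exponential sums -/

/-- The additive character `e(x) = exp(2πix)`. -/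
noncomputable def expi (x : ℝ) : ℂ := Complex.exp (((2 * Real.pi * x : ℝ) : ℂ) * Complex.I)

lemma norm_expi (x : ℝ) : ‖expi x‖ = 1 := Complex.norm_exp_ofReal_mul_I _

lemma expi_zero : expi 0 = 1 := by simp [expi]

lemma expi_add (x y : ℝ) : expi (x + y) = expi x * expi y := by
  rw [expi, expi, expi, ← Complex.exp_add]
  congr 1
  push_cast
  ring

lemma expi_intCast (k : ℤ) : expi k = 1 := by
  rw [expi, Complex.exp_eq_one_iff]
  exact ⟨k, by push_cast; ring⟩

lemma expi_neg (x : ℝ) : expi (-x) = (starRingEnd ℂ) (expi x) := by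
  rw [expi, expi, ← Complex.exp_conj, map_mul, Complex.conj_ofReal, Complex.conj_I]
  congr 1
  push_cast
  ring

lemma expi_sub_intCast (x : ℝ) (k : ℤ) : expi (x - k) = expi x := by
  rw [sub_eq_add_neg, expi_add, ← Int.cast_neg, expi_intCast, mul_one]

lemma expi_sq_form (x : ℝ) : expi x =
    ((Real.cos (Real.pi * x) : ℂ) + (Real.sin (Real.pi * x) : ℂ) * Complex.I) ^ 2 := by
  rw [Complex.ofReal_cos, Complex.ofReal_sin, ← Complex.exp_mul_I, ← Complex.exp_nat_mul, expi]
  congr 1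
  push_cast
  ring

/-! ### The Kusmin–Landau inequality. -/

/-- `cot (π x)`. -/
noncomputable def cotPi (x : ℝ) : ℝ := Real.cos (Real.pi * x) / Real.sin (Real.pi * x)

/-- The function `1 / (e(x) - 1) = -1/2 - (i/2) cot (π x)`. -/
noncomputable def invExpiSubOne (x : ℝ) : ℂ := -(1 / 2) - ((cotPi x / 2 : ℝ) : ℂ) * Complex.I

lemma expi_mul_invExpiSubOne {x : ℝ} (hx : Real.sin (Real.pi * x) ≠ 0) :
    expi x * invExpiSubOne x = 1 + invExpiSubOne x := by
  have h1 : ((Real.sin (Real.pi * x) : ℝ) : ℂ) ≠ 0 := by exact_mod_cast hx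
  have h2 : ((Real.sin (Real.pi * x) : ℝ) : ℂ) ^ 2 + ((Real.cos (Real.pi * x) : ℝ) : ℂ) ^ 2 = 1 := by
    exact_mod_cast Real.sin_sq_add_cos_sq (Real.pi * x)
  rw [expi_sq_form, invExpiSubOne, cotPi]
  push_cast at *
  set s := Complex.sin (Real.pi * x)
  set t := Complex.cos (Real.pi * x)
  have hI : Complex.I ^ 2 = -1 := Complex.I_sq
  field_simp
  linear_combination (s - t * Complex.I) * h2 + (-s ^ 3 - t * s ^ 2 * Complex.I - 2 * s * t ^ 2) * hI

/-- Jordan's inequality on the first half of the period, and symmetry about `1/2` on the other. -/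
lemma sin_pi_mul_lower {θ x : ℝ} (hθ : 0 < θ) (h1 : θ ≤ x) (h2 : x ≤ 1 - θ) :
    2 * θ ≤ Real.sin (Real.pi * x) := by
  have hpi := Real.pi_pos
  have key : ∀ y : ℝ, θ ≤ y → y ≤ 1 / 2 → 2 * θ ≤ Real.sin (Real.pi * y) := by
    intro y hy1 hy2
    have := Real.mul_le_sin (x := Real.pi * y) (by nlinarith) (by nlinarith)
    have h3 : 2 / Real.pi * (Real.pi * y) = 2 * y := by field_simp
    linarith
  rcases le_total x (1 / 2) with h | h
  · exact key x h1 h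
  · have h4 := key (1 - x) (by linarith) (by linarith)
    have h5 : Real.pi * (1 - x) = Real.pi - Real.pi * x := by ring
    rwa [h5, Real.sin_pi_sub] at h4

lemma abs_cotPi_le {θ x : ℝ} (hθ : 0 < θ) (h1 : θ ≤ x) (h2 : x ≤ 1 - θ) :
    |cotPi x| ≤ 1 / (2 * θ) := by
  have h := sin_pi_mul_lower hθ h1 h2
  rw [cotPi, abs_div, abs_of_pos (by linarith : 0 < Real.sin (Real.pi * x))]
  exact div_le_div₀ zero_le_one (Real.abs_cos_le_one _) (by positivity) h

lemma norm_invExpiSubOne_le {θ x : ℝ} (hθ : 0 < θ) (h1 : θ ≤ x) (h2 : x ≤ 1 - θ) :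
    ‖invExpiSubOne x‖ ≤ 1 / (2 * θ) := by
  have h := abs_cotPi_le hθ h1 h2
  have hθ2 : θ ≤ 1 / 2 := by linarith
  have h3 : 1 / 2 ≤ 1 / (4 * θ) := by
    rw [div_le_div_iff₀ (by norm_num) (by positivity)]
    linarith
  calc ‖invExpiSubOne x‖ ≤ ‖(-(1 / 2) : ℂ)‖ + ‖((cotPi x / 2 : ℝ) : ℂ) * Complex.I‖ :=
        norm_sub_le _ _
    _ = 1 / 2 + |cotPi x| / 2 := by
        rw [norm_mul, Complex.norm_I, Complex.norm_real, Real.norm_eq_abs, abs_div]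
        norm_num
    _ ≤ 1 / (4 * θ) + (1 / (2 * θ)) / 2 := by gcongr
    _ = 1 / (2 * θ) := by field_simp; norm_num

lemma cotPi_anti {θ x y : ℝ} (hθ : 0 < θ) (h1 : θ ≤ x) (hxy : x ≤ y) (h2 : y ≤ 1 - θ) :
    cotPi y ≤ cotPi x := by
  have hx := sin_pi_mul_lower hθ h1 (hxy.trans h2)
  have hy := sin_pi_mul_lower hθ (h1.trans hxy) h2
  have hs : 0 ≤ Real.sin (Real.pi * y - Real.pi * x) := by
    apply Real.sin_nonneg_of_nonneg_of_le_pi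
    · nlinarith [Real.pi_pos]
    · nlinarith [Real.pi_pos]
  rw [Real.sin_sub] at hs
  rw [cotPi, cotPi, div_le_div_iff₀ (by linarith) (by linarith)]
  linarith

/-- With `K_m = 1/(e(g_m) - 1)` and `g_m` the first difference, `e(f m) = (e(f (m+1)) - e(f m))
K_m`, so the sum can be summed by parts. All `K_m` have real part `-1/2` and an imaginary part
monotone in `m`, so their total variation telescopes to a difference of cotangents. The last
boundary term stays on the left so that the induction closes. -/
lemma kusmin_landau_aux (f : ℕ → ℝ) {θ : ℝ} (hθ : 0 < θ) (p d : ℕ)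
    (hg : ∀ m, p ≤ m → m ≤ p + d → θ ≤ f (m + 1) - f m ∧ f (m + 1) - f m ≤ 1 - θ)
    (hmono : ∀ m, p ≤ m → m < p + d → f (m + 1) - f m ≤ f (m + 2) - f (m + 1)) :
    ‖∑ m ∈ Finset.Ico p (p + d + 1), expi (f m)
        - expi (f (p + d + 1)) * invExpiSubOne (f (p + d + 1) - f (p + d))‖
      ≤ ‖invExpiSubOne (f (p + 1) - f p)‖
        + (cotPi (f (p + 1) - f p) - cotPi (f (p + d + 1) - f (p + d))) / 2 := by
  have step : ∀ m, p ≤ m → m ≤ p + d → expi (f (m + 1)) * invExpiSubOne (f (m + 1) - f m)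
      = expi (f m) + expi (f m) * invExpiSubOne (f (m + 1) - f m) := by
    intro m h1 h2
    have hs := sin_pi_mul_lower hθ (hg m h1 h2).1 (hg m h1 h2).2
    have h := expi_mul_invExpiSubOne (x := f (m + 1) - f m) (by linarith)
    have h3 : f (m + 1) = f m + (f (m + 1) - f m) := by ring
    conv_lhs => rw [h3, expi_add]
    rw [show f m + (f (m + 1) - f m) - f m = f (m + 1) - f m by ring, mul_assoc, h]
    ring
  induction d with
  | zero =>
    simp only [add_zero]
    rw [step p le_rfl (by simp)]
    simp [norm_expi]
  | succ d ih =>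
    have ih' := ih (fun m h1 h2 => hg m h1 (by omega)) (fun m h1 h2 => hmono m h1 (by omega))
      (fun m h1 h2 => step m h1 (by omega))
    have hst := step (p + (d + 1)) (by omega) le_rfl
    rw [Finset.sum_Ico_succ_top (by omega), hst]
    have hc : cotPi (f (p + (d + 1) + 1) - f (p + (d + 1))) ≤ cotPi (f (p + d + 1) - f (p + d)) :=
      cotPi_anti hθ (hg (p + d) (by omega) (by omega)).1 (hmono (p + d) (by omega) (by omega))
        (hg (p + (d + 1)) (by omega) (by omega)).2
    have hd : p + (d + 1) = p + d + 1 := by ring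
    rw [hd] at hst hc ⊢
    set S := ∑ m ∈ Finset.Ico p (p + d + 1), expi (f m)
    set E := expi (f (p + d + 1))
    set K := invExpiSubOne (f (p + d + 1) - f (p + d)) with hK
    set K' := invExpiSubOne (f (p + d + 1 + 1) - f (p + d + 1)) with hK'
    -- Trading the boundary term `E * K` for `E * K'` costs `E * (K - K')`, whose norm is exactly
    -- half the drop of the cotangent.
    have h5 : S + E - (E + E * K') = (S - E * K) + E * (K - K') := by ring
    rw [h5]
    have h6 : ‖E * (K - K')‖ = (cotPi (f (p + d + 1) - f (p + d))
        - cotPi (f (p + d + 1 + 1) - f (p + d + 1))) / 2 := by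
      rw [norm_mul, norm_expi, one_mul, hK, hK', invExpiSubOne, invExpiSubOne]
      rw [show ∀ u v : ℝ, (-(1 / 2) - ((u / 2 : ℝ) : ℂ) * Complex.I
        - (-(1 / 2) - ((v / 2 : ℝ) : ℂ) * Complex.I)) = ((-((u - v) / 2) : ℝ) : ℂ) * Complex.I by
          intro u v; push_cast; ring]
      rw [norm_mul, Complex.norm_I, mul_one, Complex.norm_real, norm_neg, Real.norm_eq_abs,
        abs_of_nonneg]
      linarith
    calc _ ≤ ‖S - E * K‖ + ‖E * (K - K')‖ := norm_add_le _ _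
      _ ≤ _ := by rw [h6]; linarith

/-- The Kusmin–Landau inequality on an interval. -/
lemma kusmin_landau (f : ℕ → ℝ) {θ : ℝ} (hθ : 0 < θ) (p d : ℕ)
    (hg : ∀ m, p ≤ m → m ≤ p + d → θ ≤ f (m + 1) - f m ∧ f (m + 1) - f m ≤ 1 - θ)
    (hmono : ∀ m, p ≤ m → m < p + d → f (m + 1) - f m ≤ f (m + 2) - f (m + 1)) :
    ‖∑ m ∈ Finset.Ico p (p + d + 1), expi (f m)‖ ≤ 2 / θ := by
  have h := kusmin_landau_aux f hθ p d hg hmono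
  have hp := hg p le_rfl (by simp)
  have hq := hg (p + d) (by simp) le_rfl
  have h1 := norm_invExpiSubOne_le hθ hp.1 hp.2
  have h2 := norm_invExpiSubOne_le hθ hq.1 hq.2
  have h3 := abs_le.1 (abs_cotPi_le hθ hp.1 hp.2)
  have h4 := abs_le.1 (abs_cotPi_le hθ hq.1 hq.2)
  have h5 := norm_le_norm_sub_add (∑ m ∈ Finset.Ico p (p + d + 1), expi (f m))
    (expi (f (p + d + 1)) * invExpiSubOne (f (p + d + 1) - f (p + d)))
  rw [norm_mul, norm_expi, one_mul] at h5
  -- Three contributions of at most `1 / (2θ)` arise: two boundary terms and half a difference of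
  -- cotangents. A fourth is slack.
  have h6 : 2 / θ = 4 * (1 / (2 * θ)) := by field_simp; norm_num
  rw [h6]
  have : 0 < 1 / (2 * θ) := by positivity
  linarith [h3.1, h3.2, h4.1, h4.2]

lemma finset_eq_Ico_of_ordConnected (s : Finset ℕ) (hs : s.Nonempty)
    (h : ∀ i ∈ s, ∀ j ∈ s, ∀ k, i ≤ k → k ≤ j → k ∈ s) :
    ∃ p d, s = Finset.Ico p (p + d + 1) := by
  refine ⟨s.min' hs, s.max' hs - s.min' hs, ?_⟩
  have hle : s.min' hs ≤ s.max' hs := s.min'_le_max' hs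
  ext k
  rw [Finset.mem_Ico]
  constructor
  · intro hk
    have := s.min'_le k hk
    have := s.le_max' k hk
    omega
  · intro hk
    exact h _ (s.min'_mem hs) _ (s.max'_mem hs) k hk.1 (by omega)

/-! ### The second derivative test. -/

section SecondDifference

variable {f : ℕ → ℝ} {M : ℕ} {L : ℝ}

/-- A sum over a set of indices on which the first difference is confined to
`[k + θ, k + 1 - θ]`. -/
lemma norm_sum_filter_le (hL : 0 < L) {θ : ℝ} (hθ : 0 < θ)
    (hg : ∀ i j, i ≤ j → j < M → L * ((j : ℝ) - i) ≤ (f (j + 1) - f j) - (f (i + 1) - f i))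
    (k : ℤ) :
    ‖∑ m ∈ Finset.range M with k + θ ≤ f (m + 1) - f m ∧ f (m + 1) - f m ≤ k + 1 - θ,
      expi (f m)‖ ≤ 2 / θ := by
  set s := {m ∈ Finset.range M | k + θ ≤ f (m + 1) - f m ∧ f (m + 1) - f m ≤ k + 1 - θ}
  have mono : ∀ i j, i ≤ j → j < M → f (i + 1) - f i ≤ f (j + 1) - f j := by
    intro i j hij hj
    have h1 := hg i j hij hj
    have h2 : (i : ℝ) ≤ j := by exact_mod_cast hij
    have : 0 ≤ L * ((j : ℝ) - i) := mul_nonneg hL.le (by linarith)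
    linarith
  have hmem : ∀ m, m ∈ s ↔ m < M ∧ k + θ ≤ f (m + 1) - f m ∧ f (m + 1) - f m ≤ k + 1 - θ := by
    intro m; simp [s]
  rcases s.eq_empty_or_nonempty with h | h
  · rw [h]
    simp only [Finset.sum_empty, norm_zero]
    positivity
  obtain ⟨p, d, hpd⟩ := finset_eq_Ico_of_ordConnected s h (by
    intro i hi j hj l hil hlj
    rw [hmem] at *
    have := mono i l hil (by omega)
    have := mono l j hlj (by omega)
    exact ⟨by omega, by linarith [hi.2.1], by linarith [hj.2.2]⟩)
  have hmem2 : ∀ m, p ≤ m → m ≤ p + d → m < M ∧ k + θ ≤ f (m + 1) - f m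
      ∧ f (m + 1) - f m ≤ k + 1 - θ := by
    intro m h1 h2
    rw [← hmem, hpd, Finset.mem_Ico]
    omega
  -- Subtracting the integer `k * m` from the phase leaves the summand unchanged and moves the first
  -- differences into `[θ, 1 - θ]`.
  have hshift : ∀ m : ℕ, expi (f m) = expi (f m - k * m) := by
    intro m
    have := expi_sub_intCast (f m) (k * m)
    push_cast at this
    exact this.symm
  rw [hpd, Finset.sum_congr rfl (fun m _ => hshift m)]
  apply kusmin_landau (fun m : ℕ => f m - k * m) hθ p d
  · intro m h1 h2
    have := hmem2 m h1 h2
    push_cast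
    constructor <;> linarith [this.2.1, this.2.2]
  · intro m h1 h2
    have h3 := hmem2 (m + 1) (by omega) (by omega)
    have h4 := mono m (m + 1) (by omega) h3.1
    push_cast
    have h5 : m + 1 + 1 = m + 2 := rfl
    rw [h5] at h4
    linarith

/-- The number of indices whose first difference lies in a given interval of length `w`. -/
lemma card_filter_le (hL : 0 < L) {w : ℝ} (hw : 0 ≤ w)
    (hg : ∀ i j, i ≤ j → j < M → L * ((j : ℝ) - i) ≤ (f (j + 1) - f j) - (f (i + 1) - f i))
    (s : Finset ℕ) (hs : s ⊆ Finset.range M) (x : ℝ)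
    (hx : ∀ m ∈ s, x ≤ f (m + 1) - f m ∧ f (m + 1) - f m ≤ x + w) :
    (s.card : ℝ) ≤ w / L + 1 := by
  rcases s.eq_empty_or_nonempty with h | h
  · rw [h]
    simp only [Finset.card_empty, Nat.cast_zero]
    positivity
  set p := s.min' h
  set q := s.max' h
  have hpq : p ≤ q := s.min'_le_max' h
  have hp := hx p (s.min'_mem h)
  have hq := hx q (s.max'_mem h)
  have h1 := hg p q hpq (Finset.mem_range.1 (hs (s.max'_mem h)))
  have h2 : (q : ℝ) - p ≤ w / L := by
    rw [le_div_iff₀ hL]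
    linarith [hp.1, hq.2]
  have h3 : s.card ≤ q + 1 - p := by
    rw [← Nat.card_Ico]
    apply Finset.card_le_card
    intro m hm
    rw [Finset.mem_Ico]
    have := s.min'_le m hm
    have := s.le_max' m hm
    omega
  have h4 : (s.card : ℝ) ≤ ((q + 1 - p : ℕ) : ℝ) := by exact_mod_cast h3
  rw [Nat.cast_sub (by omega)] at h4
  push_cast at h4
  linarith

/-- Van der Corput's second derivative test, for sequences. -/
lemma second_difference_test (hL : 0 < L) {θ V : ℝ} (hθ : 0 < θ) (hV : 0 ≤ V)
    (hg : ∀ i j, i ≤ j → j < M → L * ((j : ℝ) - i) ≤ (f (j + 1) - f j) - (f (i + 1) - f i))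
    (hvar : ∀ j, j < M → (f (j + 1) - f j) - (f 1 - f 0) ≤ V) :
    ‖∑ m ∈ Finset.range M, expi (f m)‖ ≤ (V + 2) * (2 * (θ / L + 1) + 2 / θ) := by
  set B := 2 * (θ / L + 1) + 2 / θ with hB
  have hB0 : 0 ≤ B := by positivity
  rcases Nat.eq_zero_or_pos M with h0 | hM
  · subst h0
    simp only [Finset.range_zero, Finset.sum_empty, norm_zero]
    positivity
  have mono : ∀ j, j < M → f 1 - f 0 ≤ f (j + 1) - f j := by
    intro j hj
    have h1 := hg 0 j (by omega) hj
    have : 0 ≤ L * ((j : ℝ) - (0 : ℕ)) := mul_nonneg hL.le (by simp)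
    linarith
  set a := ⌊f 1 - f 0⌋
  set b := ⌊f 1 - f 0 + V⌋
  have hmaps : ∀ m ∈ Finset.range M, ⌊f (m + 1) - f m⌋ ∈ Finset.Icc a b := by
    intro m hm
    rw [Finset.mem_range] at hm
    rw [Finset.mem_Icc]
    exact ⟨Int.floor_le_floor (mono m hm), Int.floor_le_floor (by linarith [hvar m hm])⟩
  -- Within one block the first difference has integer part `k`. Indices within `θ` of either end
  -- are counted trivially, at most `θ / L + 1` each; the middle ones form an interval to which
  -- Kusmin–Landau applies.
  have hblock : ∀ k : ℤ, ‖∑ m ∈ Finset.range M with ⌊f (m + 1) - f m⌋ = k, expi (f m)‖ ≤ B := by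
    intro k
    set s := {m ∈ Finset.range M | ⌊f (m + 1) - f m⌋ = k}
    set mid := {m ∈ Finset.range M | k + θ ≤ f (m + 1) - f m ∧ f (m + 1) - f m ≤ k + 1 - θ}
    set lo := {m ∈ s | f (m + 1) - f m < k + θ}
    set hi := {m ∈ {m ∈ s | ¬ f (m + 1) - f m < k + θ} | ¬ f (m + 1) - f m ≤ k + 1 - θ}
    have hmid : {m ∈ {m ∈ s | ¬ f (m + 1) - f m < k + θ} | f (m + 1) - f m ≤ k + 1 - θ} = mid := by
      ext m
      simp only [s, mid, Finset.mem_filter, Finset.mem_range, not_lt, Int.floor_eq_iff]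
      constructor
      · rintro ⟨⟨⟨h1, h2⟩, h3⟩, h4⟩
        exact ⟨h1, h3, h4⟩
      · rintro ⟨h1, h2, h3⟩
        exact ⟨⟨⟨h1, by linarith, by linarith⟩, h2⟩, h3⟩
    have hsplit : ∑ m ∈ s, expi (f m)
        = ∑ m ∈ lo, expi (f m) + (∑ m ∈ mid, expi (f m) + ∑ m ∈ hi, expi (f m)) := by
      rw [← hmid, Finset.sum_filter_add_sum_filter_not, Finset.sum_filter_add_sum_filter_not]
    have hcard : ∀ t : Finset ℕ, ‖∑ m ∈ t, expi (f m)‖ ≤ t.card := by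
      intro t
      calc _ ≤ ∑ m ∈ t, ‖expi (f m)‖ := norm_sum_le _ _
        _ = t.card := by simp [norm_expi]
    have hss : s ⊆ Finset.range M := Finset.filter_subset _ _
    have hlo : (lo.card : ℝ) ≤ θ / L + 1 := by
      refine card_filter_le hL hθ.le hg lo ((Finset.filter_subset _ _).trans hss) k ?_
      intro m hm
      simp only [lo, s, Finset.mem_filter, Int.floor_eq_iff] at hm
      exact ⟨hm.1.2.1, hm.2.le⟩
    have hhi : (hi.card : ℝ) ≤ θ / L + 1 := by
      refine card_filter_le hL hθ.le hg hi
        ((Finset.filter_subset _ _).trans ((Finset.filter_subset _ _).trans hss)) (k + 1 - θ) ?_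
      intro m hm
      simp only [hi, s, Finset.mem_filter, Int.floor_eq_iff, not_le] at hm
      exact ⟨hm.2.le, by linarith [hm.1.1.2.2]⟩
    have hm := norm_sum_filter_le hL hθ hg k
    rw [hsplit]
    have h1 := norm_add_le (∑ m ∈ lo, expi (f m)) (∑ m ∈ mid, expi (f m) + ∑ m ∈ hi, expi (f m))
    have h2 := norm_add_le (∑ m ∈ mid, expi (f m)) (∑ m ∈ hi, expi (f m))
    have h3 := hcard lo
    have h4 := hcard hi
    rw [hB]
    linarith
  rw [← Finset.sum_fiberwise_of_maps_to hmaps]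
  calc _ ≤ ∑ k ∈ Finset.Icc a b, ‖∑ m ∈ Finset.range M with ⌊f (m + 1) - f m⌋ = k, expi (f m)‖ :=
        norm_sum_le _ _
    _ ≤ ∑ k ∈ Finset.Icc a b, B := Finset.sum_le_sum (fun k _ => hblock k)
    _ = ((Finset.Icc a b).card : ℝ) * B := by simp
    -- The first differences span an interval of length at most `V`, which meets at most `V + 2`
    -- unit blocks.
    _ ≤ (V + 2) * B := by
        apply mul_le_mul_of_nonneg_right _ hB0
        rw [Int.card_Icc]
        have hab : a ≤ b := Int.floor_le_floor (by linarith)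
        have h1 : (((b + 1 - a).toNat : ℤ) : ℝ) = ((b + 1 - a : ℤ) : ℝ) := by
          rw [Int.toNat_of_nonneg (by omega)]
        push_cast at h1
        rw [h1]
        have h2 := Int.floor_le (f 1 - f 0 + V)
        have h3 := Int.lt_floor_add_one (f 1 - f 0)
        linarith

end SecondDifference

/-! ### Exponential sums with phase `α m ± n m^a`. -/

/-- The increments `(m + 1) ^ a - m ^ a`. -/
noncomputable def rpowIncr (a : ℝ) (m : ℕ) : ℝ := ((m : ℝ) + 1) ^ a - (m : ℝ) ^ a

lemma rpowIncr_nonneg {a : ℝ} (ha : 0 ≤ a) (m : ℕ) : 0 ≤ rpowIncr a m :=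
  sub_nonneg.2 (Real.rpow_le_rpow (by positivity) (by linarith) ha)

/-- On `(0, X)` the second derivative of `x^a` is at most `-a(1-a) X^(a-2)`, so adding this
quadratic preserves concavity. Only continuity is needed at the endpoint `0`, where `x^a` is not
differentiable. -/
lemma concaveOn_rpow_add_sq {a : ℝ} (ha0 : 0 < a) (ha1 : a < 1) (X : ℝ) :
    ConcaveOn ℝ (Icc 0 X) (fun x => x ^ a + a * (1 - a) / 2 * X ^ (a - 2) * x ^ 2) := by
  have hd1 : ∀ x : ℝ, 0 < x → HasDerivAt
      (fun x => x ^ a + a * (1 - a) / 2 * X ^ (a - 2) * x ^ 2)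
      (a * x ^ (a - 1) + a * (1 - a) * X ^ (a - 2) * x) x := by
    intro x hx
    have h1 := Real.hasDerivAt_rpow_const (x := x) (p := a) (Or.inl hx.ne')
    have h2 := (hasDerivAt_pow 2 x).const_mul (a * (1 - a) / 2 * X ^ (a - 2))
    convert! h1.add h2 using 1
    push_cast
    ring
  have hd2 : ∀ x : ℝ, 0 < x → HasDerivAt
      (fun x => a * x ^ (a - 1) + a * (1 - a) * X ^ (a - 2) * x)
      (a * ((a - 1) * x ^ (a - 2)) + a * (1 - a) * X ^ (a - 2)) x := by
    intro x hx
    have h1 := (Real.hasDerivAt_rpow_const (x := x) (p := a - 1) (Or.inl hx.ne')).const_mul a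
    have h2 := (hasDerivAt_id x).const_mul (a * (1 - a) * X ^ (a - 2))
    convert! h1.add h2 using 1
    rw [show a - 1 - 1 = a - 2 by ring, mul_one]
  refine concaveOn_of_hasDerivWithinAt2_nonpos (convex_Icc 0 X) (Continuous.continuousOn
    ((Real.continuous_rpow_const ha0.le).add (by fun_prop)))
    (f' := fun x => a * x ^ (a - 1) + a * (1 - a) * X ^ (a - 2) * x)
    (f'' := fun x => a * ((a - 1) * x ^ (a - 2)) + a * (1 - a) * X ^ (a - 2)) ?_ ?_ ?_
  · rw [interior_Icc]
    exact fun x hx => (hd1 x hx.1).hasDerivWithinAt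
  · rw [interior_Icc]
    exact fun x hx => (hd2 x hx.1).hasDerivWithinAt
  · rw [interior_Icc]
    intro x hx
    have h1 : X ^ (a - 2) ≤ x ^ (a - 2) :=
      Real.rpow_le_rpow_of_nonpos hx.1 hx.2.le (by linarith)
    have h2 : 0 < a * (1 - a) := by nlinarith
    nlinarith

/-- Midpoint concavity at `m` and `m + 2`: the quadratic correction contributes exactly the lower
bound. -/
lemma rpowIncr_sub_succ {a : ℝ} (ha0 : 0 < a) (ha1 : a < 1) {N m : ℕ} (hm : m + 2 ≤ N) :
    a * (1 - a) * (N : ℝ) ^ (a - 2) ≤ rpowIncr a m - rpowIncr a (m + 1) := by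
  have hN : (m : ℝ) + 2 ≤ N := by exact_mod_cast hm
  have hm0 : (0 : ℝ) ≤ m := Nat.cast_nonneg m
  have h := (concaveOn_rpow_add_sq ha0 ha1 (N : ℝ)).2
    (show (m : ℝ) ∈ Icc (0 : ℝ) N from ⟨hm0, by linarith⟩)
    (show (m : ℝ) + 2 ∈ Icc (0 : ℝ) N from ⟨by linarith, hN⟩)
    (show (0 : ℝ) ≤ 1 / 2 by norm_num) (show (0 : ℝ) ≤ 1 / 2 by norm_num) (by norm_num)
  simp only [smul_eq_mul] at h
  rw [show (1 / 2 : ℝ) * m + 1 / 2 * (m + 2) = m + 1 by ring] at h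
  rw [rpowIncr, rpowIncr]
  push_cast
  rw [show (m : ℝ) + 1 + 1 = m + 2 by ring]
  nlinarith

lemma rpowIncr_sub {a : ℝ} (ha0 : 0 < a) (ha1 : a < 1) {N i j : ℕ} (hij : i ≤ j) (hj : j < N) :
    a * (1 - a) * (N : ℝ) ^ (a - 2) * ((j : ℝ) - i) ≤ rpowIncr a i - rpowIncr a j := by
  induction j, hij using Nat.le_induction with
  | base => simp
  | succ j hij ih =>
    have h1 := ih (by omega)
    have h2 := rpowIncr_sub_succ ha0 ha1 (N := N) (m := j) (by omega)
    push_cast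
    linarith

/-- The increments decrease, and the one at `0` equals `1`. -/
lemma rpowIncr_le_one {a : ℝ} (ha0 : 0 < a) (ha1 : a < 1) (m : ℕ) : rpowIncr a m ≤ 1 := by
  have h := rpowIncr_sub ha0 ha1 (N := m + 1) (i := 0) (j := m) (by omega) (by omega)
  have h0 : rpowIncr a 0 = 1 := by simp [rpowIncr, Real.zero_rpow ha0.ne']
  have : 0 ≤ a * (1 - a) * ((m + 1 : ℕ) : ℝ) ^ (a - 2) * ((m : ℝ) - (0 : ℕ)) := by
    have : 0 < 1 - a := by linarith
    simp only [Nat.cast_zero, sub_zero]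
    positivity
  linarith

/-- The minus sign makes the first differences `α - n * rpowIncr a m` increasing, with spacing at
least `L = n a(1-a) N^(a-2)` and total variation at most `n`. -/
lemma norm_sum_expi_rpow_le {a : ℝ} (ha0 : 0 < a) (ha1 : a < 1) (α : ℝ) {n N M : ℕ}
    (hn : 1 ≤ n) (hN : 1 ≤ N) (hM : M ≤ N) :
    ‖∑ m ∈ Finset.range M, expi (α * m - n * (m : ℝ) ^ a)‖
      ≤ 18 / √(a * (1 - a)) * (√n * (N : ℝ) ^ (1 - a / 2)) := by
  have hb : 0 < a * (1 - a) := by nlinarith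
  have hb1 : a * (1 - a) ≤ 1 := by nlinarith
  have hnR : (1 : ℝ) ≤ n := by exact_mod_cast hn
  have hNR : (1 : ℝ) ≤ N := by exact_mod_cast hN
  have hNp : (0 : ℝ) < (N : ℝ) ^ (a - 2) := Real.rpow_pos_of_pos (by linarith) _
  have hsb : 0 < √(a * (1 - a)) := Real.sqrt_pos.2 hb
  have hsb1 : √(a * (1 - a)) ≤ 1 := Real.sqrt_le_one.2 hb1
  have hpow : (N : ℝ) ^ (1 - a / 2) = 1 / √((N : ℝ) ^ (a - 2)) := by
    rw [Real.sqrt_eq_rpow, ← Real.rpow_mul (by linarith), one_div, ← Real.rpow_neg (by linarith)]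
    congr 1
    ring
  set L := n * (a * (1 - a)) * (N : ℝ) ^ (a - 2) with hL
  have hL0 : 0 < L := by positivity
  have hsL : √L = √n * √(a * (1 - a)) * √((N : ℝ) ^ (a - 2)) := by
    rw [hL, Real.sqrt_mul (by positivity), Real.sqrt_mul (by positivity)]
  -- For `L ≤ 1` the choice `θ = √L` balances `θ / L` against `1 / θ`. For `L ≥ 1` the claimed bound
  -- is at least `N`, so the trivial estimate suffices.
  rcases le_total L 1 with h1 | h1
  · have hs1 : √L ≤ 1 := Real.sqrt_le_one.2 h1
    have hs0 : 0 < √L := Real.sqrt_pos.2 hL0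
    have hdiff : ∀ m : ℕ, (α * ((m + 1 : ℕ) : ℝ) - n * ((m + 1 : ℕ) : ℝ) ^ a)
        - (α * m - n * (m : ℝ) ^ a) = α - n * rpowIncr a m := by
      intro m
      rw [rpowIncr]
      push_cast
      ring
    have key := second_difference_test (f := fun m : ℕ => α * m - n * (m : ℝ) ^ a) (M := M)
      (L := L) hL0 (θ := √L) (V := n) hs0 (by positivity) (by
        intro i j hij hj
        simp only [hdiff]
        have := rpowIncr_sub ha0 ha1 (N := N) hij (by omega)
        have h2 := mul_le_mul_of_nonneg_left this (by linarith : (0 : ℝ) ≤ n)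
        rw [hL]
        linarith) (by
        intro j hj
        simp only [hdiff]
        have h4 := rpowIncr_le_one ha0 ha1 0
        have h5 := rpowIncr_nonneg ha0.le j
        nlinarith)
    refine key.trans ?_
    have e1 : √L / L = 1 / √L := Real.sqrt_div_self'
    rw [e1]
    have h6 : 1 ≤ 1 / √L := by rw [le_div_iff₀ hs0]; linarith
    calc ((n : ℝ) + 2) * (2 * (1 / √L + 1) + 2 / √L)
        ≤ (3 * n) * (6 * (1 / √L)) := by
          apply mul_le_mul (by linarith) _ (by positivity) (by positivity)
          rw [show 2 / √L = 2 * (1 / √L) by ring]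
          linarith
      _ = 18 / √(a * (1 - a)) * (√n * (N : ℝ) ^ (1 - a / 2)) := by
          rw [hsL, hpow]
          have hn0 : 0 < √(n : ℝ) := Real.sqrt_pos.2 (by linarith)
          field_simp
          rw [Real.sq_sqrt (by linarith)]
          ring
  · have htriv : ‖∑ m ∈ Finset.range M, expi (α * m - n * (m : ℝ) ^ a)‖ ≤ M := by
      calc _ ≤ ∑ m ∈ Finset.range M, ‖expi (α * m - n * (m : ℝ) ^ a)‖ := norm_sum_le _ _
        _ = M := by simp [norm_expi]
    have hMN : (M : ℝ) ≤ N := by exact_mod_cast hM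
    have hs1 : 1 ≤ √L := Real.one_le_sqrt.2 h1
    have hP0 : 0 < (N : ℝ) ^ (1 - a / 2) := Real.rpow_pos_of_pos (by linarith) _
    have hsq : (N : ℝ) ≤ (N : ℝ) ^ (1 - a / 2) * (N : ℝ) ^ (1 - a / 2) := by
      rw [← Real.rpow_add (by linarith)]
      conv_lhs => rw [← Real.rpow_one (N : ℝ)]
      exact Real.rpow_le_rpow_of_exponent_le hNR (by linarith)
    have h7 : (N : ℝ) ^ (1 - a / 2) ≤ √n := by
      have h8 : √L ≤ √n * √((N : ℝ) ^ (a - 2)) := by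
        rw [hsL]
        have : √(n : ℝ) * √(a * (1 - a)) ≤ √n := by
          have := Real.sqrt_nonneg (n : ℝ)
          nlinarith
        exact mul_le_mul_of_nonneg_right this (Real.sqrt_nonneg _)
      have h9 : 0 < √((N : ℝ) ^ (a - 2)) := Real.sqrt_pos.2 hNp
      rw [hpow, div_le_iff₀ h9]
      linarith
    have h10 : (1 : ℝ) ≤ 18 / √(a * (1 - a)) := by
      rw [le_div_iff₀ hsb]
      linarith
    have h11 : (0 : ℝ) ≤ √n * (N : ℝ) ^ (1 - a / 2) := by positivity
    have h12 : (N : ℝ) ^ (1 - a / 2) * (N : ℝ) ^ (1 - a / 2) ≤ √n * (N : ℝ) ^ (1 - a / 2) :=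
      mul_le_mul_of_nonneg_right h7 hP0.le
    calc _ ≤ (1 : ℝ) * (√n * (N : ℝ) ^ (1 - a / 2)) := by linarith
      _ ≤ _ := mul_le_mul_of_nonneg_right h10 h11

/-- The constant in `norm_sum_expi_rpow_le`. -/
noncomputable def vdcConst (a : ℝ) : ℝ := 18 / √(a * (1 - a))

lemma vdcConst_nonneg (a : ℝ) : 0 ≤ vdcConst a := by unfold vdcConst; positivity

/-- Complex conjugation reverses the phase, at the price of replacing `α` by `-α`. -/
lemma norm_sum_expi_rpow_le' {a : ℝ} (ha0 : 0 < a) (ha1 : a < 1) (α : ℝ) {n N M : ℕ}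
    (hn : 1 ≤ n) (hN : 1 ≤ N) (hM : M ≤ N) :
    ‖∑ m ∈ Finset.range M, expi (α * m + n * (m : ℝ) ^ a)‖
      ≤ vdcConst a * (√n * (N : ℝ) ^ (1 - a / 2)) := by
  have h := norm_sum_expi_rpow_le ha0 ha1 (-α) hn hN hM
  rw [← RCLike.norm_conj, map_sum] at h
  refine le_of_eq_of_le ?_ h
  congr 1
  refine Finset.sum_congr rfl fun m _ => ?_
  rw [← expi_neg]
  congr 1
  ring

/-- The cosine is the mean of two characters, and the shift `τ` only contributes unimodular
constants. -/
lemma norm_sum_cos_mul_expi_le {a : ℝ} (ha0 : 0 < a) (ha1 : a < 1) (α τ : ℝ) {n N M : ℕ}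
    (hn : 1 ≤ n) (hN : 1 ≤ N) (hM : M ≤ N) :
    ‖∑ m ∈ Finset.range M,
        ((Real.cos (2 * Real.pi * n * (-(m : ℝ) ^ a + τ)) : ℝ) : ℂ) * expi (α * m)‖
      ≤ vdcConst a * (√n * (N : ℝ) ^ (1 - a / 2)) := by
  have hcos : ∀ x : ℝ, ((Real.cos (2 * Real.pi * x) : ℝ) : ℂ) = (expi x + expi (-x)) / 2 := by
    intro x
    rw [Complex.ofReal_cos, Complex.cos, expi, expi]
    congr 3
    push_cast
    ring_nf
  have hterm : ∀ m : ℕ, ((Real.cos (2 * Real.pi * n * (-(m : ℝ) ^ a + τ)) : ℝ) : ℂ) * expi (α * m)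
      = expi (n * τ) / 2 * expi (α * m - n * (m : ℝ) ^ a)
        + expi (-(n * τ)) / 2 * expi (α * m + n * (m : ℝ) ^ a) := by
    intro m
    rw [mul_assoc (2 * Real.pi), hcos, sub_eq_add_neg, expi_add (α * m), expi_add (α * m),
      show (n : ℝ) * (-(m : ℝ) ^ a + τ) = n * τ + -(n * (m : ℝ) ^ a) by ring, expi_add,
      show -((n : ℝ) * τ + -(n * (m : ℝ) ^ a)) = -(n * τ) + n * (m : ℝ) ^ a by ring, expi_add]
    ring
  rw [Finset.sum_congr rfl fun m _ => hterm m, Finset.sum_add_distrib, ← Finset.mul_sum,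
    ← Finset.mul_sum]
  have h1 := norm_sum_expi_rpow_le ha0 ha1 α hn hN hM
  have h2 := norm_sum_expi_rpow_le' ha0 ha1 α hn hN hM
  change _ ≤ vdcConst a * _ at h1
  refine (norm_add_le _ _).trans ?_
  rw [norm_mul, norm_mul, norm_div, norm_div, norm_expi, norm_expi]
  simp only [Complex.norm_ofNat]
  linarith

/-! ### From the second Bernoulli polynomial to the sawtooth. -/

/-- The periodic quadratic function `{s}² - {s} + 1/6`. -/
noncomputable def perBernoulliTwo (s : ℝ) : ℝ := Int.fract s ^ 2 - Int.fract s + 1 / 6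

/-- This series converges absolutely, unlike that of the sawtooth. The term `n = 0` vanishes because
division by zero gives `0`. -/
lemma hasSum_perBernoulliTwo (s : ℝ) :
    HasSum (fun n : ℕ => 1 / (n : ℝ) ^ 2 * Real.cos (2 * Real.pi * n * s))
      (Real.pi ^ 2 * perBernoulliTwo s) := by
  have h := hasSum_one_div_nat_pow_mul_cos (k := 1) one_ne_zero (x := Int.fract s)
    ⟨Int.fract_nonneg s, (Int.fract_lt_one s).le⟩
  have e1 : ∀ n : ℕ, Real.cos (2 * Real.pi * n * Int.fract s) = Real.cos (2 * Real.pi * n * s) := by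
    intro n
    have : 2 * Real.pi * n * Int.fract s
        = 2 * Real.pi * n * s - ((n * ⌊s⌋ : ℤ) : ℝ) * (2 * Real.pi) := by
      rw [Int.fract]
      push_cast
      ring
    rw [this, Real.cos_sub_int_mul_two_pi]
  simp only [mul_one, e1] at h
  convert! h using 1
  simp [Polynomial.bernoulli, Finset.sum_range_succ, perBernoulliTwo, bernoulli_two,
    bernoulli_one, Polynomial.eval_add, Nat.factorial]
  ring

/-- The sawtooth function `{s} - 1/2`. -/
noncomputable def sawtooth (s : ℝ) : ℝ := Int.fract s - 1 / 2

lemma abs_sawtooth_le (s : ℝ) : |sawtooth s| ≤ 1 / 2 := by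
  have h1 := Int.fract_nonneg s
  have h2 := Int.fract_lt_one s
  rw [abs_le, sawtooth]
  constructor <;> linarith

/-- The derivative is `2 * sawtooth`, and there is equality if no integer is crossed; crossing one
only lowers the left side. Together with `perBernoulliTwo_sub`, this places `2δ * sawtooth s`
between the forward and backward differences, up to `δ²`. -/
lemma perBernoulliTwo_add {δ : ℝ} (hδ0 : 0 < δ) (hδ1 : δ ≤ 1) (s : ℝ) :
    (perBernoulliTwo (s + δ) - perBernoulliTwo s) ≤ 2 * δ * sawtooth s + δ ^ 2 := by
  have h1 := Int.fract_nonneg s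
  have h2 := Int.fract_lt_one s
  rw [perBernoulliTwo, perBernoulliTwo, sawtooth]
  rcases lt_or_ge (Int.fract s + δ) 1 with h | h
  · have : Int.fract (s + δ) = Int.fract s + δ := by
      rw [Int.fract_eq_iff]
      exact ⟨by linarith, h, ⌊s⌋, by rw [← Int.self_sub_floor]; ring⟩
    rw [this]
    nlinarith
  · have : Int.fract (s + δ) = Int.fract s + δ - 1 := by
      rw [Int.fract_eq_iff]
      exact ⟨by linarith, by linarith, ⌊s⌋ + 1, by rw [← Int.self_sub_floor]; push_cast; ring⟩
    rw [this]
    nlinarith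

lemma perBernoulliTwo_sub {δ : ℝ} (hδ0 : 0 < δ) (hδ1 : δ ≤ 1) (s : ℝ) :
    2 * δ * sawtooth s - δ ^ 2 ≤ perBernoulliTwo s - perBernoulliTwo (s - δ) := by
  have h1 := Int.fract_nonneg s
  have h2 := Int.fract_lt_one s
  rw [perBernoulliTwo, perBernoulliTwo, sawtooth]
  rcases le_or_gt 0 (Int.fract s - δ) with h | h
  · have : Int.fract (s - δ) = Int.fract s - δ := by
      rw [Int.fract_eq_iff]
      exact ⟨by linarith, by linarith, ⌊s⌋, by rw [← Int.self_sub_floor]; ring⟩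
    rw [this]
    nlinarith
  · have : Int.fract (s - δ) = Int.fract s - δ + 1 := by
      rw [Int.fract_eq_iff]
      exact ⟨by linarith, by linarith, ⌊s⌋ - 1, by rw [← Int.self_sub_floor]; push_cast; ring⟩
    rw [this]
    nlinarith

lemma summable_sqrt_div_sq : Summable (fun n : ℕ => 1 / (n : ℝ) ^ 2 * √n) := by
  have h := (Real.summable_one_div_nat_rpow (p := 3 / 2)).2 (by norm_num)
  refine h.congr fun n => ?_
  rcases Nat.eq_zero_or_pos n with h0 | h0
  · subst h0
    simp
  have hn : (0 : ℝ) < n := by exact_mod_cast h0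
  rw [Real.sqrt_eq_rpow, one_div, one_div, ← Real.rpow_natCast, ← Real.rpow_neg hn.le,
    ← Real.rpow_neg hn.le, ← Real.rpow_add hn]
  norm_num

/-- The constant in `norm_sum_perBernoulliTwo_le`. -/
noncomputable def sawtoothConst (a : ℝ) : ℝ :=
  (∑' n : ℕ, 1 / (n : ℝ) ^ 2 * √n) * vdcConst a / Real.pi ^ 2

lemma sawtoothConst_nonneg (a : ℝ) : 0 ≤ sawtoothConst a := by
  have := vdcConst_nonneg a
  have : 0 ≤ ∑' n : ℕ, 1 / (n : ℝ) ^ 2 * √n := tsum_nonneg fun n => by positivity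
  unfold sawtoothConst
  positivity

/-- The bound is applied frequency by frequency; the loss `√n` at frequency `n` is affordable
against the Fourier coefficient `n⁻²`. -/
lemma norm_sum_perBernoulliTwo_le {a : ℝ} (ha0 : 0 < a) (ha1 : a < 1) (α τ : ℝ) {N M : ℕ}
    (hN : 1 ≤ N) (hM : M ≤ N) :
    ‖∑ m ∈ Finset.range M, (perBernoulliTwo (-(m : ℝ) ^ a + τ) : ℂ) * expi (α * m)‖
      ≤ sawtoothConst a * (N : ℝ) ^ (1 - a / 2) := by
  have hs : HasSum (fun n : ℕ => ∑ m ∈ Finset.range M,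
      ((1 / (n : ℝ) ^ 2 * Real.cos (2 * Real.pi * n * (-(m : ℝ) ^ a + τ)) : ℝ) : ℂ) * expi (α * m))
      (∑ m ∈ Finset.range M,
        ((Real.pi ^ 2 * perBernoulliTwo (-(m : ℝ) ^ a + τ) : ℝ) : ℂ) * expi (α * m)) := by
    refine hasSum_sum fun m _ => ?_
    exact (Complex.hasSum_ofReal.2 (hasSum_perBernoulliTwo (-(m : ℝ) ^ a + τ))).mul_right _
  have hb : ∀ n : ℕ, ‖∑ m ∈ Finset.range M,
      ((1 / (n : ℝ) ^ 2 * Real.cos (2 * Real.pi * n * (-(m : ℝ) ^ a + τ)) : ℝ) : ℂ) * expi (α * m)‖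
      ≤ 1 / (n : ℝ) ^ 2 * √n * (vdcConst a * (N : ℝ) ^ (1 - a / 2)) := by
    intro n
    rcases Nat.eq_zero_or_pos n with h0 | h0
    · subst h0
      simp
    have h1 := norm_sum_cos_mul_expi_le ha0 ha1 α τ h0 hN hM
    simp only [Complex.ofReal_mul, mul_assoc ((1 / (n : ℝ) ^ 2 : ℝ) : ℂ)]
    rw [← Finset.mul_sum, norm_mul, Complex.norm_real, Real.norm_eq_abs,
      abs_of_nonneg (by positivity)]
    calc _ ≤ 1 / (n : ℝ) ^ 2 * (vdcConst a * (√n * (N : ℝ) ^ (1 - a / 2))) :=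
          mul_le_mul_of_nonneg_left (by simpa only [Complex.ofReal_mul] using h1) (by positivity)
      _ = _ := by ring
  have h2 := hs.norm_le_of_bounded (summable_sqrt_div_sq.mul_right _).hasSum hb
  rw [tsum_mul_right] at h2
  have h3 : ∑ m ∈ Finset.range M,
        ((Real.pi ^ 2 * perBernoulliTwo (-(m : ℝ) ^ a + τ) : ℝ) : ℂ) * expi (α * m)
      = ((Real.pi ^ 2 : ℝ) : ℂ) *
        ∑ m ∈ Finset.range M, (perBernoulliTwo (-(m : ℝ) ^ a + τ) : ℂ) * expi (α * m) := by
    rw [Finset.mul_sum]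
    exact Finset.sum_congr rfl fun m _ => by push_cast; ring
  rw [h3, norm_mul, Complex.norm_real, Real.norm_eq_abs, abs_of_nonneg (by positivity)] at h2
  rw [sawtoothConst, div_mul_eq_mul_div, le_div_iff₀ (by positivity)]
  linarith

/-- The sawtooth is replaced by a forward difference quotient. The error enters in absolute value,
so the twist no longer matters there, and the sandwich dominates it by second differences of
`perBernoulliTwo`, whose sum is controlled by the case `α = 0`. -/
lemma norm_sum_sawtooth_le_of_le {a : ℝ} (ha0 : 0 < a) (ha1 : a < 1) (α : ℝ) {N M : ℕ}
    (hN : 1 ≤ N) (hM : M ≤ N) {δ : ℝ} (hδ0 : 0 < δ) (hδ1 : δ ≤ 1) :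
    ‖∑ m ∈ Finset.range M, (sawtooth (-(m : ℝ) ^ a) : ℂ) * expi (α * m)‖
      ≤ 3 * sawtoothConst a * (N : ℝ) ^ (1 - a / 2) / δ + 3 / 2 * δ * N := by
  set q := perBernoulliTwo
  set X := sawtoothConst a * (N : ℝ) ^ (1 - a / 2) with hX
  set s : ℕ → ℝ := fun m => -(m : ℝ) ^ a with hs
  have hq : ∀ β τ : ℝ, ‖∑ m ∈ Finset.range M, (q (s m + τ) : ℂ) * expi (β * m)‖ ≤ X :=
    fun β τ => norm_sum_perBernoulliTwo_le ha0 ha1 β τ hN hM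
  have hreal : ∀ τ : ℝ, |∑ m ∈ Finset.range M, q (s m + τ)| ≤ X := by
    intro τ
    have h := hq 0 τ
    simp only [zero_mul, expi_zero, mul_one] at h
    rwa [← Complex.ofReal_sum, Complex.norm_real] at h
  have hMN : (M : ℝ) ≤ N := by exact_mod_cast hM
  have hsplit : ∑ m ∈ Finset.range M, (2 * δ * sawtooth (s m) : ℂ) * expi (α * m)
      = (∑ m ∈ Finset.range M, (q (s m + δ) : ℂ) * expi (α * m)
        - ∑ m ∈ Finset.range M, (q (s m + 0) : ℂ) * expi (α * m))
        + ∑ m ∈ Finset.range M,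
          ((2 * δ * sawtooth (s m) - (q (s m + δ) - q (s m)) : ℝ) : ℂ) * expi (α * m) := by
    rw [← Finset.sum_sub_distrib, ← Finset.sum_add_distrib]
    refine Finset.sum_congr rfl fun m _ => ?_
    rw [add_zero]
    push_cast
    ring
  have herr : ‖∑ m ∈ Finset.range M,
        ((2 * δ * sawtooth (s m) - (q (s m + δ) - q (s m)) : ℝ) : ℂ) * expi (α * m)‖
      ≤ 4 * X + 3 * δ ^ 2 * M := by
    calc _ ≤ ∑ m ∈ Finset.range M,
          ‖((2 * δ * sawtooth (s m) - (q (s m + δ) - q (s m)) : ℝ) : ℂ) * expi (α * m)‖ :=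
          norm_sum_le _ _
      _ ≤ ∑ m ∈ Finset.range M,
          -- Backward minus forward difference can be as low as `-2 δ²`; adding `3 δ²` dominates the
          -- error in both directions.
          ((q (s m + 0) - q (s m + -δ)) - (q (s m + δ) - q (s m + 0)) + 3 * δ ^ 2) := by
          refine Finset.sum_le_sum fun m _ => ?_
          rw [norm_mul, norm_expi, mul_one, Complex.norm_real, Real.norm_eq_abs, add_zero,
            ← sub_eq_add_neg]
          have h1 := perBernoulliTwo_add hδ0 hδ1 (s m)
          have h2 := perBernoulliTwo_sub hδ0 hδ1 (s m)
          have h3 : 0 ≤ δ ^ 2 := by positivity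
          rw [abs_le]
          constructor <;> linarith
      _ = (∑ m ∈ Finset.range M, q (s m + 0) - ∑ m ∈ Finset.range M, q (s m + -δ))
          - (∑ m ∈ Finset.range M, q (s m + δ) - ∑ m ∈ Finset.range M, q (s m + 0))
          + 3 * δ ^ 2 * M := by
          rw [Finset.sum_add_distrib, Finset.sum_sub_distrib, Finset.sum_sub_distrib,
            Finset.sum_sub_distrib, Finset.sum_const, Finset.card_range, nsmul_eq_mul]
          ring
      _ ≤ _ := by
          have h1 := abs_le.1 (hreal 0)
          have h2 := abs_le.1 (hreal (-δ))
          have h3 := abs_le.1 (hreal δ)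
          linarith [h1.1, h1.2, h2.1, h2.2, h3.1, h3.2]
  have htot : ‖∑ m ∈ Finset.range M, (2 * δ * sawtooth (s m) : ℂ) * expi (α * m)‖
      ≤ 6 * X + 3 * δ ^ 2 * N := by
    rw [hsplit]
    refine (norm_add_le _ _).trans ?_
    have h1 := norm_sub_le (∑ m ∈ Finset.range M, (q (s m + δ) : ℂ) * expi (α * m))
      (∑ m ∈ Finset.range M, (q (s m + 0) : ℂ) * expi (α * m))
    have h2 := hq α δ
    have h3 := hq α 0
    have h4 : 3 * δ ^ 2 * (M : ℝ) ≤ 3 * δ ^ 2 * N :=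
      mul_le_mul_of_nonneg_left hMN (by positivity)
    linarith
  have hfac : ∑ m ∈ Finset.range M, (2 * δ * sawtooth (s m) : ℂ) * expi (α * m)
      = ((2 * δ : ℝ) : ℂ) * ∑ m ∈ Finset.range M, (sawtooth (s m) : ℂ) * expi (α * m) := by
    rw [Finset.mul_sum]
    exact Finset.sum_congr rfl fun m _ => by push_cast; ring
  rw [hfac, norm_mul, Complex.norm_real, Real.norm_eq_abs, abs_of_pos (by positivity)] at htot
  have hgoal : 3 * sawtoothConst a * (N : ℝ) ^ (1 - a / 2) / δ + 3 / 2 * δ * N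
      = (6 * X + 3 * δ ^ 2 * N) / (2 * δ) := by
    rw [hX]
    field_simp
    ring
  rw [hgoal, le_div_iff₀ (by positivity)]
  linarith

lemma norm_sum_sawtooth_le {a : ℝ} (ha0 : 0 < a) (ha1 : a < 1) (α : ℝ) {N M : ℕ}
    (hN : 1 ≤ N) (hM : M ≤ N) :
    ‖∑ m ∈ Finset.range M, (sawtooth (-(m : ℝ) ^ a) : ℂ) * expi (α * m)‖
      ≤ (3 * sawtoothConst a + 3 / 2) * (N : ℝ) ^ (1 - a / 4) := by
  have hNR : (1 : ℝ) ≤ N := by exact_mod_cast hN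
  have hN0 : (0 : ℝ) < N := by linarith
  -- The choice `δ = N^(-a/4)` balances `N^(1-a/2) / δ` against `δ N`.
  have hδ0 : 0 < (N : ℝ) ^ (-(a / 4)) := Real.rpow_pos_of_pos hN0 _
  have h := norm_sum_sawtooth_le_of_le ha0 ha1 α hN hM hδ0
    (Real.rpow_le_one_of_one_le_of_nonpos hNR (by linarith))
  refine h.trans (le_of_eq ?_)
  have e1 : (N : ℝ) ^ (1 - a / 2) / (N : ℝ) ^ (-(a / 4)) = (N : ℝ) ^ (1 - a / 4) := by
    rw [← Real.rpow_sub hN0]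
    congr 1
    ring
  have e2 : (N : ℝ) ^ (-(a / 4)) * N = (N : ℝ) ^ (1 - a / 4) := by
    conv_lhs => rw [← Real.rpow_one (N : ℝ), ← Real.rpow_mul hN0.le, ← Real.rpow_add hN0]
    congr 1
    ring
  rw [mul_div_assoc, e1, mul_assoc (3 / 2), e2]
  ring

/-! ### Discrepancy between the counts and their smooth model. -/

/-- The number of natural `n` with `m ^ a ≤ n < (m + 1) ^ a`. -/
noncomputable def fiberCount (a : ℝ) (m : ℕ) : ℕ := ⌈((m : ℝ) + 1) ^ a⌉₊ - ⌈(m : ℝ) ^ a⌉₊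

/-- For `x ≥ 0` one has `⌈x⌉ = x + {-x} = x + sawtooth (-x) + 1/2`, and the constants cancel in the
difference. -/
lemma fiberCount_sub_rpowIncr {a : ℝ} (ha0 : 0 < a) (m : ℕ) :
    (fiberCount a m : ℝ) - rpowIncr a m
      = sawtooth (-((m + 1 : ℕ) : ℝ) ^ a) - sawtooth (-(m : ℝ) ^ a) := by
  have key : ∀ x : ℝ, 0 ≤ x → (⌈x⌉₊ : ℝ) = x + sawtooth (-x) + 1 / 2 := by
    intro x hx
    rw [natCast_ceil_eq_intCast_ceil hx, sawtooth, ← Int.self_sub_floor, Int.floor_neg]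
    push_cast
    ring
  have hle : ⌈(m : ℝ) ^ a⌉₊ ≤ ⌈((m : ℝ) + 1) ^ a⌉₊ :=
    Nat.ceil_mono (Real.rpow_le_rpow (by positivity) (by linarith) ha0.le)
  rw [fiberCount, Nat.cast_sub hle, key _ (by positivity), key _ (by positivity), rpowIncr]
  push_cast
  ring

/-- Shifting the index in the first sawtooth multiplies its sum by `e(-α)` and leaves two boundary
terms of size at most `1/2`, so twice the sawtooth bound applies. -/
lemma norm_sum_fiberCount_sub_le {a : ℝ} (ha0 : 0 < a) (ha1 : a < 1) (α : ℝ) {N M : ℕ}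
    (hN : 1 ≤ N) (hM : M ≤ N) :
    ‖∑ m ∈ Finset.range M, ((fiberCount a m - rpowIncr a m : ℝ) : ℂ) * expi (α * m)‖
      ≤ (6 * sawtoothConst a + 4) * (N : ℝ) ^ (1 - a / 4) := by
  set b : ℕ → ℂ := fun m => (sawtooth (-(m : ℝ) ^ a) : ℂ) * expi (α * m) with hb
  have hb1 : ∀ m, ‖b m‖ ≤ 1 / 2 := by
    intro m
    rw [hb]
    simp only
    rw [norm_mul, norm_expi, mul_one, Complex.norm_real]
    exact abs_sawtooth_le _
  have h1 : ∑ m ∈ Finset.range M, ((fiberCount a m - rpowIncr a m : ℝ) : ℂ) * expi (α * m)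
      = expi (-α) * (∑ m ∈ Finset.range M, b m + b M - b 0) - ∑ m ∈ Finset.range M, b m := by
    rw [← Finset.sum_range_succ, Finset.sum_range_succ', add_sub_cancel_right, Finset.mul_sum,
      ← Finset.sum_sub_distrib]
    refine Finset.sum_congr rfl fun m _ => ?_
    rw [fiberCount_sub_rpowIncr ha0, hb]
    simp only
    have : expi (α * m) = expi (-α) * expi (α * (m + 1 : ℕ)) := by
      rw [← expi_add]
      congr 1
      push_cast
      ring
    push_cast at this ⊢
    rw [sub_mul]
    nth_rewrite 1 [this]
    ring
  have h2 := norm_sum_sawtooth_le ha0 ha1 α hN hM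
  have hP : 1 ≤ (N : ℝ) ^ (1 - a / 4) :=
    Real.one_le_rpow (by exact_mod_cast hN) (by linarith)
  change ‖∑ m ∈ Finset.range M, b m‖ ≤ _ at h2
  rw [h1]
  calc _ ≤ ‖expi (-α) * (∑ m ∈ Finset.range M, b m + b M - b 0)‖ + ‖∑ m ∈ Finset.range M, b m‖ :=
        norm_sub_le _ _
    _ ≤ (‖∑ m ∈ Finset.range M, b m‖ + ‖b M‖ + ‖b 0‖) + ‖∑ m ∈ Finset.range M, b m‖ := by
        rw [norm_mul, norm_expi, one_mul]
        have := norm_sub_le (∑ m ∈ Finset.range M, b m + b M) (b 0)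
        have := norm_add_le (∑ m ∈ Finset.range M, b m) (b M)
        linarith
    _ ≤ _ := by
        have := hb1 M
        have := hb1 0
        linarith

/-- Partial summation against a monotone weight. -/
lemma norm_sum_monotone_mul_le {w : ℕ → ℝ} (hw : Monotone w) (hw0 : 0 ≤ w 0) {z : ℕ → ℂ} {M : ℕ}
    {B : ℝ} (hB : ∀ M' ≤ M, ‖∑ m ∈ Finset.range M', z m‖ ≤ B) :
    ‖∑ m ∈ Finset.range M, (w m : ℂ) * z m‖ ≤ 2 * w M * B := by
  have hB0 : 0 ≤ B := (norm_nonneg _).trans (hB M le_rfl)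
  have key : ∀ M' ≤ M, ‖∑ m ∈ Finset.range M', (w m : ℂ) * z m
      - w M' * ∑ m ∈ Finset.range M', z m‖ ≤ (w M' - w 0) * B := by
    intro M' hM'
    induction M' with
    | zero => simp
    | succ j ih =>
      have h1 := ih (by omega)
      have h2 : ∑ m ∈ Finset.range (j + 1), (w m : ℂ) * z m
          - w (j + 1) * ∑ m ∈ Finset.range (j + 1), z m
          = (∑ m ∈ Finset.range j, (w m : ℂ) * z m - w j * ∑ m ∈ Finset.range j, z m)
            - ((w (j + 1) - w j : ℝ) : ℂ) * ∑ m ∈ Finset.range (j + 1), z m := by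
        rw [Finset.sum_range_succ, Finset.sum_range_succ z]
        push_cast
        ring
      rw [h2]
      refine (norm_sub_le _ _).trans ?_
      rw [norm_mul, Complex.norm_real, Real.norm_eq_abs,
        abs_of_nonneg (sub_nonneg.2 (hw (Nat.le_succ j)))]
      have h3 := mul_le_mul_of_nonneg_left (hB (j + 1) hM') (sub_nonneg.2 (hw (Nat.le_succ j)))
      linarith
  have h1 := key M le_rfl
  have h2 := norm_le_norm_sub_add (∑ m ∈ Finset.range M, (w m : ℂ) * z m)
    (w M * ∑ m ∈ Finset.range M, z m)
  have hwM : 0 ≤ w M := hw0.trans (hw (Nat.zero_le M))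
  rw [norm_mul, Complex.norm_real, Real.norm_eq_abs, abs_of_nonneg hwM] at h2
  have h3 := mul_le_mul_of_nonneg_left (hB M le_rfl) hwM
  nlinarith

lemma norm_sum_pow_mul_fiberCount_sub_le {a : ℝ} (ha0 : 0 < a) (ha1 : a < 1) (α : ℝ) (k : ℕ)
    {N : ℕ} (hN : 1 ≤ N) :
    ‖∑ m ∈ Finset.range N, ((m ^ k * (fiberCount a m - rpowIncr a m) : ℝ) : ℂ) * expi (α * m)‖
      ≤ (12 * sawtoothConst a + 8) * (N ^ k * (N : ℝ) ^ (1 - a / 4)) := by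
  have h := norm_sum_monotone_mul_le (w := fun m : ℕ => (m : ℝ) ^ k)
    (fun i j hij => by simp only; gcongr) (by positivity)
    (z := fun m => ((fiberCount a m - rpowIncr a m : ℝ) : ℂ) * expi (α * m))
    (fun M' hM' => norm_sum_fiberCount_sub_le ha0 ha1 α hN hM')
  refine le_of_eq_of_le ?_ (h.trans (le_of_eq (by ring)))
  congr 1
  refine Finset.sum_congr rfl fun m _ => ?_
  push_cast
  ring

/-! ### Trilinear forms via the finite Fourier transform -/

lemma expi_eq_one_iff (x : ℝ) : expi x = 1 ↔ ∃ k : ℤ, x = k := by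
  constructor
  · intro h
    rw [expi, Complex.exp_eq_one_iff] at h
    obtain ⟨k, hk⟩ := h
    refine ⟨k, ?_⟩
    have h2 : ((2 * Real.pi : ℝ) : ℂ) * Complex.I ≠ 0 := by
      simp [Real.pi_ne_zero]
    have h3 : (x : ℂ) = ((k : ℝ) : ℂ) := by
      apply mul_right_cancel₀ h2
      push_cast at hk ⊢
      linear_combination hk
    exact_mod_cast h3
  · rintro ⟨k, rfl⟩
    exact expi_intCast k

lemma expi_nat_mul (n : ℕ) (x : ℝ) : expi (n * x) = expi x ^ n := by
  rw [expi, expi, ← Complex.exp_nat_mul]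
  congr 1
  push_cast
  ring

/-- Orthogonality of additive characters modulo `Q`. -/
lemma sum_expi_div {Q : ℕ} (hQ : 0 < Q) {t : ℤ} (ht : |t| < Q) :
    ∑ j ∈ Finset.range Q, expi (j / Q * t) = if t = 0 then (Q : ℂ) else 0 := by
  have hQ0 : (Q : ℝ) ≠ 0 := by exact_mod_cast hQ.ne'
  have hterm : ∀ j : ℕ, expi (j / Q * t) = expi (t / Q) ^ j := by
    intro j
    rw [← expi_nat_mul]
    congr 1
    ring
  rw [Finset.sum_congr rfl fun j _ => hterm j]
  split_ifs with h
  · simp [h, expi_zero]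
  · have h1 : expi (t / Q) ≠ 1 := by
      intro h1
      obtain ⟨k, hk⟩ := (expi_eq_one_iff _).1 h1
      rw [div_eq_iff hQ0] at hk
      have hk' : t = k * Q := by exact_mod_cast hk
      apply h
      apply Int.eq_zero_of_abs_lt_dvd (m := (Q : ℤ)) ⟨k, by rw [hk']; ring⟩ ht
    rw [geom_sum_eq h1, ← expi_nat_mul, mul_div_cancel₀ _ hQ0, expi_intCast]
    simp

/-- The Fourier transform of the restriction of `f` to `{0, …, N}`. -/
noncomputable def trigSum (f : ℕ → ℝ) (N : ℕ) (α : ℝ) : ℂ :=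
  ∑ m ∈ Finset.range (N + 1), (f m : ℂ) * expi (α * m)

/-- Parseval modulo `Q`: as `N < Q`, distinct indices in `{0, …, N}` stay distinct modulo `Q`. -/
lemma sum_norm_sq_trigSum (g : ℕ → ℝ) {N Q : ℕ} (hQ : N < Q) :
    ∑ j ∈ Finset.range Q, ‖trigSum g N (j / Q)‖ ^ 2 = Q * ∑ m ∈ Finset.range (N + 1), g m ^ 2 := by
  have h : ∀ j : ℕ, ((‖trigSum g N (j / Q)‖ ^ 2 : ℝ) : ℂ) = ∑ m ∈ Finset.range (N + 1),
      ∑ l ∈ Finset.range (N + 1), (g m * g l : ℂ) * expi (j / Q * ((m : ℤ) - (l : ℤ) : ℤ)) := by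
    intro j
    rw [Complex.ofReal_pow, ← Complex.mul_conj', trigSum, map_sum, Finset.sum_mul_sum]
    refine Finset.sum_congr rfl fun m _ => Finset.sum_congr rfl fun l _ => ?_
    rw [map_mul, Complex.conj_ofReal, ← expi_neg]
    push_cast
    rw [mul_sub, sub_eq_add_neg, expi_add]
    ring
  have key : ((∑ j ∈ Finset.range Q, ‖trigSum g N (j / Q)‖ ^ 2 : ℝ) : ℂ)
      = ((Q * ∑ m ∈ Finset.range (N + 1), g m ^ 2 : ℝ) : ℂ) := by
    rw [Complex.ofReal_sum, Finset.sum_congr rfl fun j _ => h j, Finset.sum_comm]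
    push_cast
    rw [Finset.mul_sum]
    refine Finset.sum_congr rfl fun m hm => ?_
    rw [Finset.sum_comm]
    have h2 : ∀ l ∈ Finset.range (N + 1), ∑ j ∈ Finset.range Q,
        (g m * g l : ℂ) * expi (j / Q * ((m : ℝ) - l))
        = if m = l then (Q : ℂ) * (g m * g l) else 0 := by
      intro l hl
      rw [Finset.mem_range] at hl hm
      have h3 := sum_expi_div (Q := Q) (by omega) (t := (m : ℤ) - l) (by
        rw [abs_lt]; constructor <;> omega)
      push_cast at h3
      rw [← Finset.mul_sum, h3]
      simp only [sub_eq_zero, Nat.cast_inj]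
      split_ifs
      · ring
      · ring
    rw [Finset.sum_congr rfl h2, Finset.sum_ite_eq, if_pos hm]
    ring
  exact_mod_cast key

lemma sum_sum_ite_add_eq {R : Type*} [AddCommMonoid R] (φ : ℕ → ℕ → R) {n N : ℕ} (hn : n ≤ N) :
    ∑ i ∈ Finset.range (N + 1), ∑ j ∈ Finset.range (N + 1), (if i + j = n then φ i j else 0)
      = ∑ p ∈ Finset.HasAntidiagonal.antidiagonal n, φ p.1 p.2 := by
  rw [← Finset.sum_product', ← Finset.sum_filter]
  refine Finset.sum_congr ?_ fun _ _ => rfl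
  ext p
  simp only [Finset.mem_filter, Finset.mem_product, Finset.mem_range, Finset.HasAntidiagonal.mem_antidiagonal]
  omega

lemma coeff_mul_mul_eq_sum (f g h : ℕ → ℝ) (N : ℕ) :
    PowerSeries.coeff N (PowerSeries.mk f * (PowerSeries.mk g * PowerSeries.mk h))
      = ∑ i ∈ Finset.range (N + 1), ∑ j ∈ Finset.range (N + 1), ∑ l ∈ Finset.range (N + 1),
        if i + (j + l) = N then f i * (g j * h l) else 0 := by
  rw [PowerSeries.coeff_mul, Finset.Nat.sum_antidiagonal_eq_sum_range_succ_mk]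
  refine Finset.sum_congr rfl fun i hi => ?_
  rw [Finset.mem_range] at hi
  have h1 : ∀ j l : ℕ, (i + (j + l) = N) = (j + l = N - i) := fun j l => by
    apply propext; omega
  simp only [h1]
  rw [sum_sum_ite_add_eq (fun j l => f i * (g j * h l)) (by omega : N - i ≤ N), PowerSeries.coeff_mul,
    PowerSeries.coeff_mk, Finset.mul_sum]
  simp

/-- A discrete circle method. Here `i + k + l - N` lies in `[-N, 2N]`, so for this `Q` its vanishing
modulo `Q` is actual vanishing. -/
lemma sum_trigSum_mul_mul (f g h : ℕ → ℝ) (N : ℕ) {Q : ℕ} (hQ : Q = 3 * N + 1) :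
    ∑ j ∈ Finset.range Q, trigSum f N (j / Q) * (trigSum g N (j / Q) * trigSum h N (j / Q))
        * expi (-(j / Q * N))
      = Q * (PowerSeries.coeff N (PowerSeries.mk f * (PowerSeries.mk g * PowerSeries.mk h)) : ℝ) := by
  have hexp : ∀ j : ℕ, trigSum f N (j / Q) * (trigSum g N (j / Q) * trigSum h N (j / Q))
        * expi (-(j / Q * N))
      = ∑ i ∈ Finset.range (N + 1), ∑ k ∈ Finset.range (N + 1), ∑ l ∈ Finset.range (N + 1),
        (f i * (g k * h l) : ℂ) * expi (j / Q * ((i : ℤ) + (k + l) - N : ℤ)) := by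
    intro j
    rw [trigSum, trigSum, trigSum, Finset.sum_mul_sum, Finset.sum_mul_sum, Finset.sum_mul]
    refine Finset.sum_congr rfl fun i _ => ?_
    rw [Finset.sum_mul]
    refine Finset.sum_congr rfl fun k _ => ?_
    rw [Finset.mul_sum, Finset.sum_mul]
    refine Finset.sum_congr rfl fun l _ => ?_
    push_cast
    rw [show (j : ℝ) / Q * ((i : ℝ) + (k + l) - N)
      = j / Q * i + (j / Q * k + j / Q * l) + -(j / Q * N) by ring, expi_add, expi_add, expi_add]
    ring
  rw [Finset.sum_congr rfl fun j _ => hexp j, Finset.sum_comm, coeff_mul_mul_eq_sum]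
  push_cast
  rw [Finset.mul_sum]
  refine Finset.sum_congr rfl fun i hi => ?_
  rw [Finset.sum_comm, Finset.mul_sum]
  refine Finset.sum_congr rfl fun k hk => ?_
  rw [Finset.sum_comm, Finset.mul_sum]
  refine Finset.sum_congr rfl fun l hl => ?_
  rw [Finset.mem_range] at hi hk hl
  have h3 := sum_expi_div (Q := Q) (by omega) (t := (i : ℤ) + (k + l) - N) (by
    rw [abs_lt]; constructor <;> omega)
  push_cast at h3
  rw [← Finset.mul_sum, h3]
  have h4 : ((i : ℤ) + (k + l) - N = 0) = (i + (k + l) = N) := by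
    apply propext; omega
  simp only [h4]
  split_ifs
  · push_cast
    ring
  · simp

/-- A trilinear form is controlled by the sup norm of the Fourier transform of one function and the
`ℓ²` norms of the two others. -/
lemma abs_coeff_mul_mul_le (f g h : ℕ → ℝ) (N : ℕ) {B G H : ℝ}
    (hf : ∀ α, ‖trigSum f N α‖ ≤ B)
    (hG : ∑ m ∈ Finset.range (N + 1), g m ^ 2 ≤ G) (hH : ∑ m ∈ Finset.range (N + 1), h m ^ 2 ≤ H) :
    |PowerSeries.coeff N (PowerSeries.mk f * (PowerSeries.mk g * PowerSeries.mk h))|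
      ≤ B * (√G * √H) := by
  obtain ⟨Q, hQ⟩ : ∃ Q : ℕ, Q = 3 * N + 1 := ⟨_, rfl⟩
  have hQ0 : (0 : ℝ) < Q := by
    rw [hQ]
    positivity
  have hB0 : 0 ≤ B := (norm_nonneg _).trans (hf 0)
  have h1 := sum_trigSum_mul_mul f g h N hQ
  have h2 : (Q : ℝ) * |PowerSeries.coeff N (PowerSeries.mk f * (PowerSeries.mk g * PowerSeries.mk h))|
      = ‖∑ j ∈ Finset.range Q, trigSum f N (j / Q) * (trigSum g N (j / Q) * trigSum h N (j / Q))
        * expi (-(j / Q * N))‖ := by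
    rw [h1, norm_mul, Complex.norm_real, Complex.norm_natCast, Real.norm_eq_abs]
  have h3 : ‖∑ j ∈ Finset.range Q, trigSum f N (j / Q) * (trigSum g N (j / Q) * trigSum h N (j / Q))
        * expi (-(j / Q * N))‖
      ≤ B * ∑ j ∈ Finset.range Q, ‖trigSum g N (j / Q)‖ * ‖trigSum h N (j / Q)‖ := by
    rw [Finset.mul_sum]
    refine (norm_sum_le _ _).trans (Finset.sum_le_sum fun j _ => ?_)
    rw [norm_mul, norm_mul, norm_mul, norm_expi, mul_one]
    exact mul_le_mul_of_nonneg_right (hf _) (by positivity)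
  -- Cauchy–Schwarz followed by Parseval; the two factors `√Q` cancel the normalization `Q`.
  have h4 := Real.sum_mul_le_sqrt_mul_sqrt (Finset.range Q)
    (fun j : ℕ => ‖trigSum g N (j / Q)‖) (fun j : ℕ => ‖trigSum h N (j / Q)‖)
  rw [sum_norm_sq_trigSum g (by omega), sum_norm_sq_trigSum h (by omega),
    Real.sqrt_mul hQ0.le, Real.sqrt_mul hQ0.le] at h4
  have h5 : √(Q : ℝ) * √(∑ m ∈ Finset.range (N + 1), g m ^ 2)
      * (√Q * √(∑ m ∈ Finset.range (N + 1), h m ^ 2)) ≤ Q * (√G * √H) := by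
    have h6 := Real.mul_self_sqrt hQ0.le
    have h7 := Real.sqrt_le_sqrt hG
    have h8 := Real.sqrt_le_sqrt hH
    calc _ = (√(Q : ℝ) * √Q) * (√(∑ m ∈ Finset.range (N + 1), g m ^ 2)
          * √(∑ m ∈ Finset.range (N + 1), h m ^ 2)) := by ring
      _ ≤ _ := by
        rw [h6]
        gcongr
  have h9 := mul_le_mul_of_nonneg_left (h4.trans h5) hB0
  have h10 : (Q : ℝ) * |PowerSeries.coeff N (PowerSeries.mk f * (PowerSeries.mk g * PowerSeries.mk h))|
      ≤ Q * (B * (√G * √H)) := by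
    rw [h2]
    linarith
  exact le_of_mul_le_mul_left h10 hQ0

/-! ### Asymptotics of convolutions -/

/-- The coefficients `p (p + 1) ⋯ (p + m - 1) / m!` of `(1 - z) ^ (-p)`. -/
noncomputable def risingCoeff (p : ℝ) : ℕ → ℝ
  | 0 => 1
  | m + 1 => risingCoeff p m * (p + m) / (m + 1)

lemma risingCoeff_pos {p : ℝ} (hp : 0 < p) (m : ℕ) : 0 < risingCoeff p m := by
  induction m with
  | zero => simp [risingCoeff]
  | succ m ih =>
    rw [risingCoeff]
    positivity

lemma risingCoeff_succ_mul (p : ℝ) (m : ℕ) :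
    ((m + 1 : ℕ) : ℝ) * risingCoeff p (m + 1) = (p + m) * risingCoeff p m := by
  rw [risingCoeff]
  push_cast
  field_simp

/-- The Chu–Vandermonde identity. -/
lemma sum_risingCoeff_mul (p q : ℝ) (n : ℕ) :
    ∑ x ∈ Finset.HasAntidiagonal.antidiagonal n, risingCoeff p x.1 * risingCoeff q x.2 = risingCoeff (p + q) n := by
  induction n with
  | zero => simp [risingCoeff]
  | succ n ih =>
    have hn : ((n + 1 : ℕ) : ℝ) ≠ 0 := by positivity
    apply mul_left_cancel₀ hn
    rw [risingCoeff_succ_mul, ← ih, Finset.mul_sum, Finset.mul_sum]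
    -- Writing `n + 1 = x.1 + x.2` is the product rule for the generating functions.
    have h1 : ∑ x ∈ Finset.HasAntidiagonal.antidiagonal (n + 1),
        ((n + 1 : ℕ) : ℝ) * (risingCoeff p x.1 * risingCoeff q x.2)
        = ∑ x ∈ Finset.HasAntidiagonal.antidiagonal (n + 1), (x.1 : ℝ) * risingCoeff p x.1 * risingCoeff q x.2
          + ∑ x ∈ Finset.HasAntidiagonal.antidiagonal (n + 1), (x.2 : ℝ) * risingCoeff q x.2 * risingCoeff p x.1 := by
      rw [← Finset.sum_add_distrib]
      refine Finset.sum_congr rfl fun x hx => ?_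
      rw [← Finset.HasAntidiagonal.mem_antidiagonal.1 hx]
      push_cast
      ring
    rw [h1, Finset.Nat.sum_antidiagonal_succ, Finset.Nat.sum_antidiagonal_succ']
    simp only [Nat.cast_zero, zero_mul, zero_add]
    rw [← Finset.sum_add_distrib]
    refine Finset.sum_congr rfl fun x hx => ?_
    rw [risingCoeff_succ_mul, risingCoeff_succ_mul, ← Finset.HasAntidiagonal.mem_antidiagonal.1 hx]
    push_cast
    ring

lemma risingCoeff_eq_prod (p : ℝ) (n : ℕ) :
    risingCoeff p n * (n.factorial : ℝ) = ∏ j ∈ Finset.range n, (p + j) := by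
  induction n with
  | zero => simp [risingCoeff]
  | succ n ih =>
    rw [Finset.prod_range_succ, ← ih, risingCoeff, Nat.factorial_succ]
    push_cast
    field_simp

/-- Euler's limit for Gamma; its product has one more factor `p + n`, absorbed by `n / (n + p) → 1`.
-/
lemma tendsto_risingCoeff_div {p : ℝ} (hp : 0 < p) :
    Tendsto (fun n : ℕ => risingCoeff p n / (n : ℝ) ^ (p - 1)) atTop (𝓝 (1 / Real.Gamma p)) := by
  have h1 := Real.GammaSeq_tendsto_Gamma p
  have hG : Real.Gamma p ≠ 0 := (Real.Gamma_pos_of_pos hp).ne'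
  have h2 : Tendsto (fun n : ℕ => (n : ℝ) / (n + p)) atTop (𝓝 1) :=
    tendsto_natCast_div_add_atTop p
  have h3 := h2.div h1 hG
  refine h3.congr' ?_
  filter_upwards [eventually_gt_atTop 0] with n hn
  have hnR : (0 : ℝ) < n := by exact_mod_cast hn
  have hpos := risingCoeff_pos hp n
  have hf : (0 : ℝ) < n.factorial := by positivity
  have hnp : (0 : ℝ) < (n : ℝ) ^ p := Real.rpow_pos_of_pos hnR p
  simp only [Pi.div_apply]
  rw [Real.GammaSeq, Finset.prod_range_succ, ← risingCoeff_eq_prod, Real.rpow_sub_one hnR.ne']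
  have : 0 < p + n := by positivity
  field_simp
  ring

lemma tendsto_risingCoeff_div_shift {p q : ℝ} (hp : 0 < p) (hq : 0 < q) (i : ℕ) :
    Tendsto (fun n : ℕ => risingCoeff q n / risingCoeff (p + q) (n + i)) atTop (𝓝 0) := by
  induction i with
  | zero =>
    have h1 := tendsto_risingCoeff_div hq
    have h2 := tendsto_risingCoeff_div (add_pos hp hq)
    have h3 : 1 / Real.Gamma (p + q) ≠ 0 :=
      one_div_ne_zero (Real.Gamma_pos_of_pos (add_pos hp hq)).ne'
    have h4 : Tendsto (fun n : ℕ => (n : ℝ) ^ (-p)) atTop (𝓝 0) :=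
      (tendsto_rpow_neg_atTop hp).comp tendsto_natCast_atTop_atTop
    have h5 := (h1.div h2 h3).mul h4
    rw [mul_zero] at h5
    refine h5.congr' ?_
    filter_upwards [eventually_gt_atTop 0] with n hn
    have hnR : (0 : ℝ) < n := by exact_mod_cast hn
    simp only [Pi.div_apply, add_zero]
    rw [show p + q - 1 = p + (q - 1) by ring, Real.rpow_add hnR, Real.rpow_neg hnR.le]
    have := Real.rpow_pos_of_pos hnR p
    have := Real.rpow_pos_of_pos hnR (q - 1)
    have := risingCoeff_pos (add_pos hp hq) n
    field_simp
  | succ i ih =>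
    have h2 : Tendsto (fun n : ℕ => ((n + (i + 1) : ℕ) : ℝ) / ((n + (i + 1) : ℕ) + (p + q - 1)))
        atTop (𝓝 1) :=
      (tendsto_natCast_div_add_atTop (p + q - 1)).comp (tendsto_add_atTop_nat (i + 1))
    have h3 := ih.mul h2
    rw [zero_mul] at h3
    refine h3.congr fun n => ?_
    rw [← add_assoc n i 1, risingCoeff]
    have := risingCoeff_pos (add_pos hp hq) (n + i)
    have : 0 < p + q + (n + i : ℕ) := by positivity
    have e : ((n + i + 1 : ℕ) : ℝ) + (p + q - 1) = p + q + (n + i : ℕ) := by push_cast; ring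
    rw [e]
    push_cast at *
    field_simp

/-- A Toeplitz argument: by Chu–Vandermonde the normalized products are probability weights, and the
weight of each fixed first index tends to `0` by `tendsto_risingCoeff_div_shift`. Averaging a null
sequence against them gives a null sequence. -/
lemma tendsto_sum_risingCoeff_mul_zero {p q : ℝ} (hp : 0 < p) (hq : 0 < q) {u : ℕ → ℝ}
    (hu0 : ∀ i, 0 ≤ u i) (hu : Tendsto u atTop (𝓝 0)) :
    Tendsto (fun n : ℕ => (∑ x ∈ Finset.HasAntidiagonal.antidiagonal n,
      risingCoeff p x.1 * risingCoeff q x.2 * u x.1) / risingCoeff (p + q) n) atTop (𝓝 0) := by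
  obtain ⟨U, hU⟩ := hu.bddAbove_range
  have hU' : ∀ i, u i ≤ U := fun i => hU (mem_range_self i)
  have hU0 : 0 ≤ U := (hu0 0).trans (hU' 0)
  rw [Metric.tendsto_atTop]
  intro ε hε
  obtain ⟨K, hK⟩ := (Metric.tendsto_atTop.1 hu) (ε / 2) (by positivity)
  have hsmall : Tendsto (fun n : ℕ => ∑ i ∈ Finset.range K,
      risingCoeff p i * U * (risingCoeff q (n - i) / risingCoeff (p + q) n)) atTop (𝓝 0) := by
    rw [show (0 : ℝ) = ∑ i ∈ Finset.range K, risingCoeff p i * U * 0 by simp]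
    refine tendsto_finsetSum _ fun i _ => ?_
    refine Tendsto.const_mul _ ?_
    have h1 := (tendsto_risingCoeff_div_shift hp hq i).comp (tendsto_sub_atTop_nat i)
    refine h1.congr' ?_
    filter_upwards [eventually_ge_atTop i] with n hn
    simp only [Function.comp_apply]
    rw [Nat.sub_add_cancel hn]
  obtain ⟨K', hK'⟩ := (Metric.tendsto_atTop.1 hsmall) (ε / 2) (by positivity)
  refine ⟨max K K', fun n hn => ?_⟩
  have h1 := hK' n (le_of_max_le_right hn)
  have hnK : K ≤ n := le_of_max_le_left hn
  have hb := risingCoeff_pos (add_pos hp hq) n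
  rw [Real.dist_eq, sub_zero] at h1 ⊢
  have hnn : 0 ≤ ∑ x ∈ Finset.HasAntidiagonal.antidiagonal n, risingCoeff p x.1 * risingCoeff q x.2 * u x.1 :=
    Finset.sum_nonneg fun x _ => mul_nonneg
      (mul_nonneg (risingCoeff_pos hp _).le (risingCoeff_pos hq _).le) (hu0 _)
  rw [abs_of_nonneg (by positivity), div_lt_iff₀ hb]
  have h2 := (abs_lt.1 h1).2
  have h3 : ∑ x ∈ Finset.HasAntidiagonal.antidiagonal n, risingCoeff p x.1 * risingCoeff q x.2 * u x.1
      ≤ ∑ x ∈ Finset.HasAntidiagonal.antidiagonal n, risingCoeff p x.1 * risingCoeff q x.2 * (ε / 2)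
        + ∑ i ∈ Finset.range K, risingCoeff p i * U * risingCoeff q (n - i) := by
    rw [Finset.Nat.sum_antidiagonal_eq_sum_range_succ_mk,
      Finset.Nat.sum_antidiagonal_eq_sum_range_succ_mk]
    have h4 : ∑ i ∈ Finset.range K, risingCoeff p i * U * risingCoeff q (n - i)
        = ∑ i ∈ Finset.range (n + 1),
          if i < K then risingCoeff p i * U * risingCoeff q (n - i) else 0 := by
      rw [← Finset.sum_filter]
      refine Finset.sum_congr ?_ fun _ _ => rfl
      ext i
      simp only [Finset.mem_range, Finset.mem_filter]
      omega
    rw [h4, ← Finset.sum_add_distrib]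
    refine Finset.sum_le_sum fun i _ => ?_
    have hpi := risingCoeff_pos hp i
    have hqi := risingCoeff_pos hq (n - i)
    have hpq := mul_pos hpi hqi
    split_ifs with h
    · have := hU' i
      nlinarith
    · have h5 := hK i (by omega)
      rw [Real.dist_eq, sub_zero] at h5
      have := (abs_lt.1 h5).2
      nlinarith
  rw [← Finset.sum_mul, sum_risingCoeff_mul] at h3
  have h6 : ∑ i ∈ Finset.range K, risingCoeff p i * U * (risingCoeff q (n - i) / risingCoeff (p + q) n)
      = (∑ i ∈ Finset.range K, risingCoeff p i * U * risingCoeff q (n - i)) / risingCoeff (p + q) n := by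
    rw [Finset.sum_div]
    exact Finset.sum_congr rfl fun i _ => by ring
  rw [h6, div_lt_iff₀ hb] at h2
  linarith

/-- If `f ∼ A b_p` and `g ∼ B b_q` then their convolution is `∼ A B b_{p + q}`. -/
lemma tendsto_conv_div_risingCoeff {p q : ℝ} (hp : 0 < p) (hq : 0 < q) {f g : ℕ → ℝ} {A B : ℝ}
    (hf : Tendsto (fun n => f n / risingCoeff p n) atTop (𝓝 A))
    (hg : Tendsto (fun n => g n / risingCoeff q n) atTop (𝓝 B)) :
    Tendsto (fun n => PowerSeries.coeff n (PowerSeries.mk f * PowerSeries.mk g)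
      / risingCoeff (p + q) n) atTop (𝓝 (A * B)) := by
  set r := fun n => f n / risingCoeff p n with hr
  set s := fun n => g n / risingCoeff q n with hs
  obtain ⟨R, hR⟩ := hf.abs.bddAbove_range
  have hR' : ∀ i, |r i| ≤ R := fun i => hR (mem_range_self i)
  have hu : Tendsto (fun i => |r i - A|) atTop (𝓝 0) := by
    simpa using (hf.sub_const A).abs
  have hv : Tendsto (fun i => |s i - B|) atTop (𝓝 0) := by
    simpa using (hg.sub_const B).abs
  have h1 := tendsto_sum_risingCoeff_mul_zero hp hq (fun i => abs_nonneg _) hu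
  have h2 := tendsto_sum_risingCoeff_mul_zero hq hp (fun i => abs_nonneg _) hv
  have h3 := (h1.const_mul |B|).add (h2.const_mul R)
  simp only [mul_zero, add_zero] at h3
  rw [tendsto_iff_norm_sub_tendsto_zero]
  refine squeeze_zero (fun _ => norm_nonneg _) (fun n => ?_) h3
  have hb := risingCoeff_pos (add_pos hp hq) n
  -- The error is a weighted mean of `r s - A B = B (r - A) + r (s - B)`; each half is a null
  -- average, the second after exchanging the two factors.
  have e1 : PowerSeries.coeff n (PowerSeries.mk f * PowerSeries.mk g) / risingCoeff (p + q) n - A * B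
      = (∑ x ∈ Finset.HasAntidiagonal.antidiagonal n, risingCoeff p x.1 * risingCoeff q x.2
        * (r x.1 * s x.2 - A * B)) / risingCoeff (p + q) n := by
    simp only [mul_sub]
    rw [Finset.sum_sub_distrib, ← Finset.sum_mul, sum_risingCoeff_mul, sub_div, mul_comm _ (A * B),
      mul_div_assoc (A * B), div_self hb.ne', mul_one, PowerSeries.coeff_mul]
    congr 2
    refine Finset.sum_congr rfl fun x _ => ?_
    have := risingCoeff_pos hp x.1
    have := risingCoeff_pos hq x.2
    rw [PowerSeries.coeff_mk, PowerSeries.coeff_mk, hr, hs]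
    field_simp
  have e2 : ∑ x ∈ Finset.HasAntidiagonal.antidiagonal n, risingCoeff q x.1 * risingCoeff p x.2 * |s x.1 - B|
      = ∑ x ∈ Finset.HasAntidiagonal.antidiagonal n, risingCoeff p x.1 * risingCoeff q x.2 * |s x.2 - B| := by
    rw [← Finset.Nat.sum_antidiagonal_swap]
    exact Finset.sum_congr rfl fun x _ => by simp only [Prod.fst_swap, Prod.snd_swap]; ring
  rw [e1, add_comm q p, e2, ← mul_div_assoc, ← mul_div_assoc, ← add_div, Finset.mul_sum,
    Finset.mul_sum, ← Finset.sum_add_distrib, Real.norm_eq_abs, abs_div, abs_of_pos hb]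
  refine div_le_div_of_nonneg_right ((Finset.abs_sum_le_sum_abs _ _).trans
    (Finset.sum_le_sum fun x _ => ?_)) hb.le
  have hw := mul_pos (risingCoeff_pos hp x.1) (risingCoeff_pos hq x.2)
  rw [abs_mul, abs_of_pos hw]
  have h5 : |r x.1 * s x.2 - A * B| ≤ |B| * |r x.1 - A| + R * |s x.2 - B| := by
    calc _ = |B * (r x.1 - A) + r x.1 * (s x.2 - B)| := by congr 1; ring
      _ ≤ |B * (r x.1 - A)| + |r x.1 * (s x.2 - B)| := abs_add_le _ _
      _ ≤ _ := by
        rw [abs_mul, abs_mul]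
        have := mul_le_mul_of_nonneg_right (hR' x.1) (abs_nonneg (s x.2 - B))
        linarith
  have h6 := mul_le_mul_of_nonneg_left h5 hw.le
  linarith

/-! ### The smooth main term. -/

/-- After scaling by `m`, this is the derivative of `x^a` at `1` along the steps `1/m`. -/
lemma tendsto_rpowIncr_div {a : ℝ} :
    Tendsto (fun m : ℕ => rpowIncr a m / (m : ℝ) ^ (a - 1)) atTop (𝓝 a) := by
  have h1 : HasDerivAt (fun x : ℝ => x ^ a) a 1 := by
    simpa using Real.hasDerivAt_rpow_const (x := 1) (p := a) (Or.inl one_ne_zero)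
  have h2 := h1.tendsto_slope_zero_right
  have h3 : Tendsto (fun m : ℕ => ((m : ℝ))⁻¹) atTop (𝓝[>] 0) :=
    tendsto_inv_atTop_nhdsGT_zero.comp tendsto_natCast_atTop_atTop
  refine (h2.comp h3).congr' ?_
  filter_upwards [eventually_gt_atTop 0] with m hm
  have hmR : (0 : ℝ) < m := by exact_mod_cast hm
  have hma : (0 : ℝ) < (m : ℝ) ^ a := Real.rpow_pos_of_pos hmR a
  simp only [Function.comp_apply, inv_inv, smul_eq_mul, Real.one_rpow]
  rw [rpowIncr, Real.rpow_sub_one hmR.ne', show (1 : ℝ) + (m : ℝ)⁻¹ = (m + 1) / m by field_simp,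
    Real.div_rpow (by positivity) hmR.le]
  field_simp

lemma tendsto_pow_mul_rpowIncr_div {a : ℝ} (ha : 0 < a) (k : ℕ) :
    Tendsto (fun m : ℕ => (m : ℝ) ^ k * rpowIncr a m / risingCoeff (a + k) m) atTop
      (𝓝 (a * Real.Gamma (a + k))) := by
  have hak : 0 < a + k := by positivity
  have hG := Real.Gamma_pos_of_pos hak
  have h1 := (tendsto_rpowIncr_div (a := a)).div (tendsto_risingCoeff_div hak)
    (one_div_ne_zero hG.ne')
  rw [div_div_eq_mul_div, div_one] at h1
  refine h1.congr' ?_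
  filter_upwards [eventually_gt_atTop 0] with m hm
  have hmR : (0 : ℝ) < m := by exact_mod_cast hm
  have := risingCoeff_pos hak m
  have hma : (0 : ℝ) < (m : ℝ) ^ (a - 1) := Real.rpow_pos_of_pos hmR _
  simp only [Pi.div_apply]
  rw [show a + k - 1 = a - 1 + k by ring, Real.rpow_add hmR, Real.rpow_natCast]
  field_simp

/-- The smooth model of the weighted counting problem. -/
lemma tendsto_coeff_rpowIncr {a : ℝ} (ha : 0 < a) (k₁ k₂ k₃ : ℕ) :
    Tendsto (fun N : ℕ => PowerSeries.coeff N
        (PowerSeries.mk (fun m => (m : ℝ) ^ k₁ * rpowIncr a m)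
          * (PowerSeries.mk (fun m => (m : ℝ) ^ k₂ * rpowIncr a m)
            * PowerSeries.mk (fun m => (m : ℝ) ^ k₃ * rpowIncr a m)))
        / (N : ℝ) ^ (3 * a + (k₁ + k₂ + k₃ : ℕ) - 1)) atTop
      (𝓝 (a ^ 3 * (Real.Gamma (a + k₁) * Real.Gamma (a + k₂) * Real.Gamma (a + k₃))
        / Real.Gamma (3 * a + (k₁ + k₂ + k₃ : ℕ)))) := by
  have hp : ∀ k : ℕ, 0 < a + k := fun k => by positivity
  have hs : 0 < 3 * a + (k₁ + k₂ + k₃ : ℕ) := by positivity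
  have h23 := tendsto_conv_div_risingCoeff (hp k₂) (hp k₃)
    (tendsto_pow_mul_rpowIncr_div ha k₂) (tendsto_pow_mul_rpowIncr_div ha k₃)
  have hmk : ∀ φ : PowerSeries ℝ, φ = PowerSeries.mk fun n => PowerSeries.coeff n φ := by
    intro φ
    ext n
    simp
  have h123 := tendsto_conv_div_risingCoeff (hp k₁) (add_pos (hp k₂) (hp k₃))
    (tendsto_pow_mul_rpowIncr_div ha k₁) h23
  rw [← hmk] at h123
  rw [show a + (k₁ : ℝ) + (a + k₂ + (a + k₃)) = 3 * a + (k₁ + k₂ + k₃ : ℕ) by push_cast; ring] at h123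
  have h := h123.mul (tendsto_risingCoeff_div hs)
  convert! h.congr fun n => ?_ using 2
  · ring
  · have := risingCoeff_pos hs n
    field_simp

/-! ### The weighted counting problem -/

/-- The number of integers `x` with `⌊|x| ^ (1 / a)⌋ = m`. -/
noncomputable def signedCount (a : ℝ) (m : ℕ) : ℝ := 2 * fiberCount a m - if m = 0 then 1 else 0

/-- The fiber is a half-open interval of length at most `1`. -/
lemma fiberCount_le_one {a : ℝ} (ha0 : 0 < a) (ha1 : a < 1) (m : ℕ) : fiberCount a m ≤ 1 := by
  have h := rpowIncr_le_one ha0 ha1 m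
  rw [rpowIncr] at h
  have h1 : ⌈((m : ℝ) + 1) ^ a⌉₊ ≤ ⌈(m : ℝ) ^ a⌉₊ + 1 := by
    rw [← Nat.ceil_add_one (by positivity)]
    exact Nat.ceil_mono (by linarith)
  rw [fiberCount]
  omega

lemma fiberCount_zero {a : ℝ} (ha0 : 0 < a) : fiberCount a 0 = 1 := by
  simp [fiberCount, Real.zero_rpow ha0.ne']

lemma signedCount_nonneg {a : ℝ} (ha0 : 0 < a) (m : ℕ) : 0 ≤ signedCount a m := by
  rw [signedCount]
  split_ifs with h
  · rw [h, fiberCount_zero ha0]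
    norm_num
  · rw [sub_zero]
    positivity

lemma sum_fiberCount {a : ℝ} (ha0 : 0 < a) (N : ℕ) :
    ∑ m ∈ Finset.range N, fiberCount a m = ⌈(N : ℝ) ^ a⌉₊ := by
  have hmono : Monotone fun m : ℕ => ⌈(m : ℝ) ^ a⌉₊ := fun i j hij =>
    Nat.ceil_mono (Real.rpow_le_rpow (by positivity) (by exact_mod_cast hij) ha0.le)
  have h := Finset.sum_range_tsub hmono N
  simp only [Nat.cast_zero, Real.zero_rpow ha0.ne', Nat.ceil_zero, tsub_zero] at h
  rw [← h]
  refine Finset.sum_congr rfl fun m _ => ?_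
  rw [fiberCount]
  push_cast
  rfl

lemma sum_rpowIncr {a : ℝ} (ha0 : 0 < a) (N : ℕ) :
    ∑ m ∈ Finset.range N, rpowIncr a m = (N : ℝ) ^ a := by
  have h := Finset.sum_range_sub (fun m : ℕ => (m : ℝ) ^ a) N
  simp only [Nat.cast_zero, Real.zero_rpow ha0.ne', sub_zero] at h
  rw [← h]
  refine Finset.sum_congr rfl fun m _ => ?_
  rw [rpowIncr]
  push_cast
  rfl

/-- The `ℓ²` bound for a weighted bounded nonnegative function. -/
lemma sum_sq_pow_mul_le {w : ℕ → ℝ} (h0 : ∀ m, 0 ≤ w m) (h2 : ∀ m, w m ≤ 2) (k N : ℕ) {S : ℝ}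
    (hS : ∑ m ∈ Finset.range (N + 1), w m ≤ S) :
    ∑ m ∈ Finset.range (N + 1), ((m : ℝ) ^ k * w m) ^ 2 ≤ ((N + 1 : ℕ) : ℝ) ^ (2 * k) * (2 * S) := by
  calc _ ≤ ∑ m ∈ Finset.range (N + 1), ((N + 1 : ℕ) : ℝ) ^ (2 * k) * (2 * w m) := by
        refine Finset.sum_le_sum fun m hm => ?_
        rw [Finset.mem_range] at hm
        rw [mul_pow, ← pow_mul, mul_comm k 2]
        have h3 : (m : ℝ) ^ (2 * k) ≤ ((N + 1 : ℕ) : ℝ) ^ (2 * k) :=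
          pow_le_pow_left₀ (by positivity) (by exact_mod_cast hm.le) _
        -- Boundedness turns the `ℓ²` norm into the mass of `w`, which in the applications is
        -- `O(N^a)` rather than `O(N)`.
        have h4 : w m ^ 2 ≤ 2 * w m := by nlinarith [h0 m, h2 m]
        exact mul_le_mul h3 h4 (by positivity) (by positivity)
    _ = ((N + 1 : ℕ) : ℝ) ^ (2 * k) * (2 * ∑ m ∈ Finset.range (N + 1), w m) := by
        rw [← Finset.mul_sum, ← Finset.mul_sum]
    _ ≤ _ := by gcongr

lemma sq_three_mul_rpow {X : ℝ} (hX : 0 < X) (a : ℝ) (k : ℕ) :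
    (3 * X ^ (k + a / 2)) ^ 2 = 9 * (X ^ (2 * k) * X ^ a) := by
  have h1 : X ^ a = (X ^ (a / 2)) ^ 2 := by
    rw [sq, ← Real.rpow_add hX]
    congr 1
    ring
  rw [Real.rpow_add hX, Real.rpow_natCast, h1]
  ring

lemma sum_sq_signedCount_le {a : ℝ} (ha0 : 0 < a) (ha1 : a < 1) (k N : ℕ) :
    ∑ m ∈ Finset.range (N + 1), ((m : ℝ) ^ k * signedCount a m) ^ 2
      ≤ (3 * ((N + 1 : ℕ) : ℝ) ^ (k + a / 2)) ^ 2 := by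
  have hX : (1 : ℝ) ≤ ((N + 1 : ℕ) : ℝ) := by push_cast; linarith [(Nat.cast_nonneg N : (0 : ℝ) ≤ N)]
  have hX1 : 1 ≤ ((N + 1 : ℕ) : ℝ) ^ a := Real.one_le_rpow hX ha0.le
  have hle : ∀ m, signedCount a m ≤ 2 * fiberCount a m := by
    intro m
    rw [signedCount]
    split_ifs <;> linarith
  have h1 : ∀ m, (fiberCount a m : ℝ) ≤ 1 := fun m => by exact_mod_cast fiberCount_le_one ha0 ha1 m
  have h := sum_sq_pow_mul_le (w := signedCount a) (signedCount_nonneg ha0)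
    (fun m => by linarith [hle m, h1 m]) k N (S := 4 * ((N + 1 : ℕ) : ℝ) ^ a) (by
      calc _ ≤ ∑ m ∈ Finset.range (N + 1), 2 * (fiberCount a m : ℝ) :=
            Finset.sum_le_sum fun m _ => hle m
        _ = 2 * ((⌈((N + 1 : ℕ) : ℝ) ^ a⌉₊ : ℕ) : ℝ) := by
            rw [← Finset.mul_sum, ← sum_fiberCount ha0]
            push_cast
            rfl
        _ ≤ _ := by
            have := (Nat.ceil_lt_add_one (by positivity : 0 ≤ ((N + 1 : ℕ) : ℝ) ^ a)).le
            linarith)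
  refine h.trans ?_
  rw [sq_three_mul_rpow (by linarith)]
  have : 0 ≤ ((N + 1 : ℕ) : ℝ) ^ (2 * k) * ((N + 1 : ℕ) : ℝ) ^ a := by positivity
  nlinarith

lemma sum_sq_rpowIncr_le {a : ℝ} (ha0 : 0 < a) (ha1 : a < 1) (k N : ℕ) :
    ∑ m ∈ Finset.range (N + 1), ((m : ℝ) ^ k * (2 * rpowIncr a m)) ^ 2
      ≤ (3 * ((N + 1 : ℕ) : ℝ) ^ (k + a / 2)) ^ 2 := by
  have hX : (1 : ℝ) ≤ ((N + 1 : ℕ) : ℝ) := by push_cast; linarith [(Nat.cast_nonneg N : (0 : ℝ) ≤ N)]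
  have h := sum_sq_pow_mul_le (w := fun m => 2 * rpowIncr a m)
    (fun m => by have := rpowIncr_nonneg ha0.le m; positivity)
    (fun m => by have := rpowIncr_le_one ha0 ha1 m; linarith) k N
    (S := 2 * ((N + 1 : ℕ) : ℝ) ^ a) (by rw [← Finset.mul_sum, sum_rpowIncr ha0])
  refine h.trans ?_
  rw [sq_three_mul_rpow (by linarith)]
  have : 0 ≤ ((N + 1 : ℕ) : ℝ) ^ (2 * k) * ((N + 1 : ℕ) : ℝ) ^ a := by positivity
  nlinarith

/-- The constant in `norm_trigSum_sub_le`. -/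
noncomputable def discrepancyConst (a : ℝ) : ℝ := 24 * sawtoothConst a + 17

/-- Twice the discrepancy of the natural numbers, plus at most `1` because `x = 0` has only one
sign. -/
lemma norm_trigSum_sub_le {a : ℝ} (ha0 : 0 < a) (ha1 : a < 1) (k N : ℕ) (α : ℝ) :
    ‖trigSum (fun m => (m : ℝ) ^ k * signedCount a m - (m : ℝ) ^ k * (2 * rpowIncr a m)) N α‖
      ≤ discrepancyConst a * ((N + 1 : ℕ) : ℝ) ^ (k + (1 - a / 4)) := by
  have hX : (1 : ℝ) ≤ ((N + 1 : ℕ) : ℝ) := by push_cast; linarith [(Nat.cast_nonneg N : (0 : ℝ) ≤ N)]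
  have h := norm_sum_pow_mul_fiberCount_sub_le ha0 ha1 α k (N := N + 1) (by omega)
  have e : trigSum (fun m => (m : ℝ) ^ k * signedCount a m - (m : ℝ) ^ k * (2 * rpowIncr a m)) N α
      = 2 * ∑ m ∈ Finset.range (N + 1),
          ((m ^ k * (fiberCount a m - rpowIncr a m) : ℝ) : ℂ) * expi (α * m)
        - ∑ m ∈ Finset.range (N + 1), if m = 0 then ((m : ℝ) ^ k : ℂ) * expi (α * m) else 0 := by
    rw [trigSum, Finset.mul_sum, ← Finset.sum_sub_distrib]
    refine Finset.sum_congr rfl fun m _ => ?_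
    rw [signedCount]
    split_ifs
    · push_cast
      ring
    · push_cast
      ring
  have h0 : ‖∑ m ∈ Finset.range (N + 1), if m = 0 then ((m : ℝ) ^ k : ℂ) * expi (α * m) else 0‖
      ≤ 1 := by
    rw [Finset.sum_ite_eq', if_pos (by simp), norm_mul, norm_expi, mul_one, norm_pow]
    exact pow_le_one₀ (norm_nonneg _) (by simp)
  have hpow : ((N + 1 : ℕ) : ℝ) ^ k * ((N + 1 : ℕ) : ℝ) ^ (1 - a / 4)
      = ((N + 1 : ℕ) : ℝ) ^ (k + (1 - a / 4)) := by
    rw [Real.rpow_add (by linarith), Real.rpow_natCast]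
  have h1 : 1 ≤ ((N + 1 : ℕ) : ℝ) ^ (k + (1 - a / 4)) :=
    Real.one_le_rpow hX (by have : (0 : ℝ) ≤ k := Nat.cast_nonneg k; linarith)
  rw [hpow] at h
  rw [e]
  refine (norm_sub_le _ _).trans ?_
  rw [norm_mul, Complex.norm_ofNat, discrepancyConst]
  linarith

/-- The weighted count of the representations of `N`, as a coefficient of a product. -/
noncomputable def weightedCount (a : ℝ) (k : Fin 3 → ℕ) (N : ℕ) : ℝ :=
  PowerSeries.coeff N (PowerSeries.mk (fun m => (m : ℝ) ^ k 0 * signedCount a m)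
    * (PowerSeries.mk (fun m => (m : ℝ) ^ k 1 * signedCount a m)
      * PowerSeries.mk (fun m => (m : ℝ) ^ k 2 * signedCount a m)))

/-- The telescoping `EEE - FFF = DEE + FDE + FFD` with `D = E - F` gives three trilinear forms, each
with one factor of small Fourier transform and two factors measured in `ℓ²`. -/
lemma abs_weightedCount_sub_le {a : ℝ} (ha0 : 0 < a) (ha1 : a < 1) (k : Fin 3 → ℕ) (N : ℕ) :
    |weightedCount a k N - 8 * PowerSeries.coeff N
        (PowerSeries.mk (fun m => (m : ℝ) ^ k 0 * rpowIncr a m)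
          * (PowerSeries.mk (fun m => (m : ℝ) ^ k 1 * rpowIncr a m)
            * PowerSeries.mk (fun m => (m : ℝ) ^ k 2 * rpowIncr a m)))|
      ≤ 27 * discrepancyConst a * ((N + 1 : ℕ) : ℝ) ^ ((k 0 + k 1 + k 2 : ℕ) + (1 + 3 * a / 4)) := by
  set X : ℝ := ((N + 1 : ℕ) : ℝ) with hXdef
  have hX : 0 < X := by rw [hXdef]; positivity
  set E : Fin 3 → ℕ → ℝ := fun i m => (m : ℝ) ^ k i * signedCount a m with hE
  set F : Fin 3 → ℕ → ℝ := fun i m => (m : ℝ) ^ k i * (2 * rpowIncr a m) with hF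
  set D : Fin 3 → ℕ → ℝ := fun i m => E i m - F i m with hD
  have hDB : ∀ i α, ‖trigSum (D i) N α‖ ≤ discrepancyConst a * X ^ (k i + (1 - a / 4)) :=
    fun i α => norm_trigSum_sub_le ha0 ha1 (k i) N α
  have hE2 : ∀ i, ∑ m ∈ Finset.range (N + 1), E i m ^ 2 ≤ (3 * X ^ (k i + a / 2)) ^ 2 :=
    fun i => sum_sq_signedCount_le ha0 ha1 (k i) N
  have hF2 : ∀ i, ∑ m ∈ Finset.range (N + 1), F i m ^ 2 ≤ (3 * X ^ (k i + a / 2)) ^ 2 :=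
    fun i => sum_sq_rpowIncr_le ha0 ha1 (k i) N
  have hsqrt : ∀ i : Fin 3, √((3 * X ^ (k i + a / 2)) ^ 2) = 3 * X ^ (k i + a / 2) :=
    fun i => Real.sqrt_sq (by positivity)
  have hbound : ∀ i j l : Fin 3, k i + (k j + k l) = k 0 + k 1 + k 2 → ∀ G H : ℕ → ℝ,
      ∑ m ∈ Finset.range (N + 1), G m ^ 2 ≤ (3 * X ^ (k j + a / 2)) ^ 2 →
      ∑ m ∈ Finset.range (N + 1), H m ^ 2 ≤ (3 * X ^ (k l + a / 2)) ^ 2 →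
      |PowerSeries.coeff N (PowerSeries.mk (D i) * (PowerSeries.mk G * PowerSeries.mk H))|
        ≤ 9 * discrepancyConst a * X ^ ((k 0 + k 1 + k 2 : ℕ) + (1 + 3 * a / 4)) := by
    intro i j l hijl G H hG hH
    have h := abs_coeff_mul_mul_le (D i) G H N (hDB i) hG hH
    rw [hsqrt, hsqrt] at h
    refine h.trans (le_of_eq ?_)
    have : X ^ ((k 0 + k 1 + k 2 : ℕ) + (1 + 3 * a / 4))
        = X ^ (k i + (1 - a / 4)) * (X ^ (k j + a / 2) * X ^ (k l + a / 2)) := by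
      rw [← Real.rpow_add hX, ← Real.rpow_add hX, ← hijl]
      congr 1
      push_cast
      ring
    rw [this]
    ring
  have hmkD : ∀ i, (PowerSeries.mk (D i) : PowerSeries ℝ)
      = PowerSeries.mk (E i) - PowerSeries.mk (F i) := by
    intro i
    ext m
    simp [hD]
  have hmkF : ∀ i, (PowerSeries.mk (F i) : PowerSeries ℝ)
      = PowerSeries.C (2 : ℝ) * PowerSeries.mk (fun m => (m : ℝ) ^ k i * rpowIncr a m) := by
    intro i
    ext m
    rw [PowerSeries.coeff_C_mul, PowerSeries.coeff_mk, PowerSeries.coeff_mk, hF]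
    ring
  have h8 : 8 * PowerSeries.coeff N
        (PowerSeries.mk (fun m => (m : ℝ) ^ k 0 * rpowIncr a m)
          * (PowerSeries.mk (fun m => (m : ℝ) ^ k 1 * rpowIncr a m)
            * PowerSeries.mk (fun m => (m : ℝ) ^ k 2 * rpowIncr a m)))
      = PowerSeries.coeff N
        (PowerSeries.mk (F 0) * (PowerSeries.mk (F 1) * PowerSeries.mk (F 2))) := by
    rw [← PowerSeries.coeff_C_mul, hmkF, hmkF, hmkF]
    congr 1
    rw [show (8 : ℝ) = 2 * (2 * 2) by norm_num, map_mul, map_mul]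
    ring
  have htel : weightedCount a k N - PowerSeries.coeff N
        (PowerSeries.mk (F 0) * (PowerSeries.mk (F 1) * PowerSeries.mk (F 2)))
      = PowerSeries.coeff N (PowerSeries.mk (D 0) * (PowerSeries.mk (E 1) * PowerSeries.mk (E 2)))
        + PowerSeries.coeff N (PowerSeries.mk (D 1) * (PowerSeries.mk (F 0) * PowerSeries.mk (E 2)))
        + PowerSeries.coeff N
          (PowerSeries.mk (D 2) * (PowerSeries.mk (F 0) * PowerSeries.mk (F 1))) := by
    rw [weightedCount, hmkD, hmkD, hmkD, ← map_sub, ← map_add, ← map_add]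
    congr 1
    simp only [hE]
    ring
  rw [h8, htel]
  have h0 := hbound 0 1 2 (by ring) (E 1) (E 2) (hE2 1) (hE2 2)
  have h1 := hbound 1 0 2 (by ring) (F 0) (E 2) (hF2 0) (hE2 2)
  have h2 := hbound 2 0 1 (by ring) (F 0) (F 1) (hF2 0) (hF2 1)
  refine (abs_add_three _ _ _).trans ?_
  linarith

/-- The asymptotic formula for the weighted number of representations. -/
lemma tendsto_weightedCount {a : ℝ} (ha0 : 8 / 9 < a) (ha1 : a < 1) (k : Fin 3 → ℕ) :
    Tendsto (fun N : ℕ => weightedCount a k N / (N : ℝ) ^ (3 * a + (k 0 + k 1 + k 2 : ℕ) - 1)) atTop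
      (𝓝 (8 * (a ^ 3 * (Real.Gamma (a + k 0) * Real.Gamma (a + k 1) * Real.Gamma (a + k 2))
        / Real.Gamma (3 * a + (k 0 + k 1 + k 2 : ℕ))))) := by
  have ha : 0 < a := by linarith
  have hmain := (tendsto_coeff_rpowIncr ha (k 0) (k 1) (k 2)).const_mul 8
  set K : ℕ := k 0 + k 1 + k 2 with hK
  set main : ℕ → ℝ := fun N => PowerSeries.coeff N
        (PowerSeries.mk (fun m => (m : ℝ) ^ k 0 * rpowIncr a m)
          * (PowerSeries.mk (fun m => (m : ℝ) ^ k 1 * rpowIncr a m)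
            * PowerSeries.mk (fun m => (m : ℝ) ^ k 2 * rpowIncr a m))) with hmaindef
  set s : ℝ := K + (1 + 3 * a / 4) with hs
  have herr : Tendsto (fun N : ℕ => (weightedCount a k N - 8 * main N)
      / (N : ℝ) ^ (3 * a + K - 1)) atTop (𝓝 0) := by
    -- The main exponent exceeds the error exponent by `(3a + K - 1) - (K + 1 + 3a/4) = 9a/4 - 2`,
    -- positive exactly for `a > 8/9`.
    have hdec : Tendsto (fun N : ℕ => 27 * discrepancyConst a * 2 ^ s
        * (N : ℝ) ^ (-(9 * a / 4 - 2))) atTop (𝓝 0) := by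
      have h1 := (tendsto_rpow_neg_atTop (y := 9 * a / 4 - 2) (by linarith)).comp
        (tendsto_natCast_atTop_atTop (R := ℝ))
      simpa using h1.const_mul (27 * discrepancyConst a * 2 ^ s)
    refine squeeze_zero_norm' ?_ hdec
    filter_upwards [eventually_gt_atTop 0] with N hN
    have hNR : (0 : ℝ) < N := by exact_mod_cast hN
    have hN1 : (1 : ℝ) ≤ N := by exact_mod_cast hN
    have hp : 0 < (N : ℝ) ^ (3 * a + K - 1) := Real.rpow_pos_of_pos hNR _
    have hdc : 0 ≤ discrepancyConst a := by
      have := sawtoothConst_nonneg a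
      unfold discrepancyConst
      positivity
    rw [norm_div, Real.norm_eq_abs, Real.norm_eq_abs, abs_of_pos hp, div_le_iff₀ hp]
    refine (abs_weightedCount_sub_le ha ha1 k N).trans ?_
    have hX : ((N + 1 : ℕ) : ℝ) ^ s ≤ (2 * N) ^ s :=
      Real.rpow_le_rpow (by positivity) (by push_cast; linarith) (by positivity)
    have e : (N : ℝ) ^ (-(9 * a / 4 - 2)) * (N : ℝ) ^ (3 * a + K - 1) = (N : ℝ) ^ s := by
      rw [← Real.rpow_add hNR]
      congr 1
      rw [hs]
      ring
    rw [Real.mul_rpow (by norm_num) hNR.le, ← e] at hX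
    calc _ ≤ 27 * discrepancyConst a
          * (2 ^ s * ((N : ℝ) ^ (-(9 * a / 4 - 2)) * (N : ℝ) ^ (3 * a + K - 1))) :=
          mul_le_mul_of_nonneg_left hX (by positivity)
      _ = _ := by ring
  have h := herr.add hmain
  rw [zero_add] at h
  refine h.congr fun N => ?_
  rw [← mul_div_assoc, ← add_div]
  simp only [hmaindef]
  ring

/-! ### Sums over the arithmetic sphere -/

/-- The integer `x` with its size replaced by `⌊|x| ^ c⌋`. -/
noncomputable def signedFloor (c : ℝ) (x : ℤ) : ℝ := (x.sign : ℝ) * ⌊|(x : ℝ)| ^ c⌋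

/-- The natural numbers `n` with `⌊n ^ c⌋ = m`. -/
noncomputable def natFiber (c : ℝ) (m : ℕ) : Finset ℕ :=
  Finset.Ico ⌈(m : ℝ) ^ (1 / c)⌉₊ ⌈((m : ℝ) + 1) ^ (1 / c)⌉₊

lemma mem_natFiber {c : ℝ} (hc : 0 < c) (m n : ℕ) : n ∈ natFiber c m ↔ ⌊(n : ℝ) ^ c⌋ = m := by
  rw [natFiber, Finset.mem_Ico, Nat.ceil_le, Nat.lt_ceil, Int.floor_eq_iff, Int.cast_natCast,
    one_div, Real.rpow_inv_le_iff_of_pos (by positivity) (by positivity) hc,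
    Real.lt_rpow_inv_iff_of_pos (by positivity) (by positivity) hc]

lemma card_natFiber (c : ℝ) (m : ℕ) : (natFiber c m).card = fiberCount (1 / c) m := by
  rw [natFiber, Nat.card_Ico, fiberCount]

/-- The integers `x` with `⌊|x| ^ c⌋ = m`. -/
noncomputable def intFiber (c : ℝ) (m : ℕ) : Finset ℤ :=
  (natFiber c m).image (fun n : ℕ => (n : ℤ)) ∪ (natFiber c m).image (fun n : ℕ => -(n : ℤ))

lemma mem_intFiber {c : ℝ} (hc : 0 < c) (m : ℕ) (x : ℤ) :
    x ∈ intFiber c m ↔ ⌊|(x : ℝ)| ^ c⌋ = m := by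
  have h1 : |(x : ℝ)| = (x.natAbs : ℝ) := by rw [Nat.cast_natAbs, Int.cast_abs]
  rw [h1, ← mem_natFiber hc, intFiber, Finset.mem_union, Finset.mem_image, Finset.mem_image]
  constructor
  · rintro (⟨n, hn, rfl⟩ | ⟨n, hn, rfl⟩)
    · simpa using hn
    · simpa using hn
  · intro h
    rcases Int.natAbs_eq x with h2 | h2
    · exact Or.inl ⟨_, h, h2.symm⟩
    · exact Or.inr ⟨_, h, h2.symm⟩

/-- The points `x` and `-x` cancel for odd `k` and reinforce for even `k`. -/
lemma sum_signedFloor_pow {c : ℝ} (hc : 0 < c) (k m : ℕ) :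
    ∑ x ∈ intFiber c m, signedFloor c x ^ k
      = if Even k then (m : ℝ) ^ k * signedCount (1 / c) m else 0 := by
  have ha : 0 < 1 / c := by positivity
  -- For `m = 0` the fiber is `{0}` and its positive and negative halves coincide; for `m > 0` they
  -- are disjoint.
  rcases Nat.eq_zero_or_pos m with h0 | h0
  · subst h0
    have hf : natFiber c 0 = {0} := by
      simp [natFiber, Real.zero_rpow (inv_pos.2 hc).ne']
    have hz : intFiber c 0 = {0} := by simp [intFiber, hf]
    rw [hz, signedCount, fiberCount_zero ha]
    simp only [Finset.sum_singleton, signedFloor, Int.sign_zero, Int.cast_zero, zero_mul,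
      Nat.cast_zero, Nat.cast_one, if_true]
    split_ifs with h
    · norm_num
    · rcases k with _ | k
      · simp at h
      · simp
  · have hpos : ∀ n ∈ natFiber c m, 0 < n := by
      intro n hn
      rw [mem_natFiber hc] at hn
      by_contra h
      have hn0 : n = 0 := by omega
      rw [hn0, Nat.cast_zero, Real.zero_rpow hc.ne', Int.floor_zero] at hn
      omega
    have hdisj : Disjoint ((natFiber c m).image (fun n : ℕ => (n : ℤ)))
        ((natFiber c m).image (fun n : ℕ => -(n : ℤ))) := by
      rw [Finset.disjoint_left]
      intro x hx hx'
      obtain ⟨n, hn, rfl⟩ := Finset.mem_image.1 hx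
      obtain ⟨n', hn', h⟩ := Finset.mem_image.1 hx'
      have := hpos n hn
      omega
    rw [intFiber, Finset.sum_union hdisj, Finset.sum_image (fun x _ y _ h => by exact_mod_cast h),
      Finset.sum_image (fun x _ y _ h => by simpa using h)]
    have e1 : ∀ n ∈ natFiber c m, signedFloor c (n : ℤ) ^ k = (m : ℝ) ^ k := by
      intro n hn
      have h1 := (mem_natFiber hc m n).1 hn
      rw [signedFloor, Int.sign_eq_one_of_pos (by exact_mod_cast hpos n hn), Int.cast_natCast,
        Nat.abs_cast, h1]
      simp
    have e2 : ∀ n ∈ natFiber c m, signedFloor c (-(n : ℤ)) ^ k = (-(m : ℝ)) ^ k := by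
      intro n hn
      have h1 := (mem_natFiber hc m n).1 hn
      rw [signedFloor, Int.sign_neg, Int.sign_eq_one_of_pos (by exact_mod_cast hpos n hn)]
      push_cast
      rw [abs_neg, Nat.abs_cast, h1]
      simp
    rw [Finset.sum_congr rfl e1, Finset.sum_congr rfl e2, Finset.sum_const, Finset.sum_const,
      card_natFiber, nsmul_eq_mul, nsmul_eq_mul, signedCount, if_neg h0.ne', sub_zero]
    split_ifs with h
    · rw [h.neg_pow]
      ring
    · rw [(Nat.not_even_iff_odd.1 h).neg_pow]
      ring

/-- The arithmetic sphere as a finite set. -/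
noncomputable def arithSphereFinset {c : ℝ} (hc : 1 ≤ c) (N : ℕ) : Finset (Fin 3 → ℤ) :=
  (arithSphere_finite hc N).toFinset

lemma mem_arithSphereFinset {c : ℝ} (hc : 1 ≤ c) (N : ℕ) (x : Fin 3 → ℤ) :
    x ∈ arithSphereFinset hc N ↔ ∑ i, ⌊|(x i : ℝ)| ^ c⌋ = (N : ℤ) := by
  rw [arithSphereFinset, Set.Finite.mem_toFinset]
  rfl

/-- The sphere is the disjoint union, over triples of floors with sum `N`, of products of fibers,
and a product function factors over each. -/
lemma sum_prod_arithSphereFinset {c : ℝ} (hc : 1 ≤ c) (N : ℕ) (g : Fin 3 → ℤ → ℝ) :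
    ∑ x ∈ arithSphereFinset hc N, ∏ i, g i (x i)
      = PowerSeries.coeff N (PowerSeries.mk (fun m => ∑ x ∈ intFiber c m, g 0 x)
        * (PowerSeries.mk (fun m => ∑ x ∈ intFiber c m, g 1 x)
          * PowerSeries.mk (fun m => ∑ x ∈ intFiber c m, g 2 x))) := by
  have hc0 : 0 < c := by linarith
  set R := Finset.range (N + 1)
  set T : Finset (ℕ × ℕ × ℕ) := {p ∈ R ×ˢ (R ×ˢ R) | p.1 + (p.2.1 + p.2.2) = N} with hT
  have hcoeff : PowerSeries.coeff N (PowerSeries.mk (fun m => ∑ x ∈ intFiber c m, g 0 x)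
        * (PowerSeries.mk (fun m => ∑ x ∈ intFiber c m, g 1 x)
          * PowerSeries.mk (fun m => ∑ x ∈ intFiber c m, g 2 x)))
      = ∑ p ∈ T, ∏ i, ∑ x ∈ intFiber c (![p.1, p.2.1, p.2.2] i), g i x := by
    rw [coeff_mul_mul_eq_sum, hT, Finset.sum_filter, Finset.sum_product]
    refine Finset.sum_congr rfl fun i _ => ?_
    rw [Finset.sum_product]
    refine Finset.sum_congr rfl fun j _ => Finset.sum_congr rfl fun l _ => ?_
    rw [Fin.prod_univ_three]
    simp only [Matrix.cons_val_zero, Matrix.cons_val_one, Matrix.cons_val, mul_assoc]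
  set fl : ℤ → ℕ := fun x => ⌊|(x : ℝ)| ^ c⌋.toNat with hfl
  have hflc : ∀ x : ℤ, ((fl x : ℕ) : ℤ) = ⌊|(x : ℝ)| ^ c⌋ := fun x =>
    Int.toNat_of_nonneg (Int.floor_nonneg.2 (by positivity))
  have hmem : ∀ x : Fin 3 → ℤ, x ∈ arithSphereFinset hc N
      ↔ fl (x 0) + (fl (x 1) + fl (x 2)) = N := by
    intro x
    rw [mem_arithSphereFinset, Fin.sum_univ_three, ← hflc, ← hflc, ← hflc]
    omega
  have hmaps : ∀ x ∈ arithSphereFinset hc N, (fl (x 0), fl (x 1), fl (x 2)) ∈ T := by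
    intro x hx
    rw [hmem] at hx
    simp only [hT, R, Finset.mem_filter, Finset.mem_product, Finset.mem_range]
    omega
  rw [hcoeff, ← Finset.sum_fiberwise_of_maps_to hmaps]
  refine Finset.sum_congr rfl fun p hp => ?_
  rw [Finset.prod_univ_sum]
  refine Finset.sum_congr ?_ fun _ _ => rfl
  ext x
  have hpN : p.1 + (p.2.1 + p.2.2) = N := by
    simp only [hT, Finset.mem_filter] at hp
    exact hp.2
  rw [Finset.mem_filter, Fintype.mem_piFinset, hmem, Fin.forall_fin_succ, Fin.forall_fin_succ,
    Fin.forall_fin_one]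
  simp only [mem_intFiber hc0, ← hflc, Nat.cast_inj, Matrix.cons_val_zero, Fin.succ_zero_eq_one,
    Matrix.cons_val_one, Fin.succ_one_eq_two, Matrix.cons_val, Prod.ext_iff]
  constructor
  · rintro ⟨-, h⟩
    exact h
  · rintro h
    refine ⟨?_, h⟩
    rw [h.1, h.2.1, h.2.2, hpN]

lemma sum_signedFloor_monomial {c : ℝ} (hc : 1 ≤ c) (N : ℕ) (k : Fin 3 → ℕ) :
    ∑ x ∈ arithSphereFinset hc N, ∏ i, signedFloor c (x i) ^ k i
      = if ∀ i, Even (k i) then weightedCount (1 / c) k N else 0 := by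
  have hc0 : 0 < c := by linarith
  rw [sum_prod_arithSphereFinset hc N (fun i x => signedFloor c x ^ k i)]
  simp only [sum_signedFloor_pow hc0]
  have hz : (PowerSeries.mk fun _ : ℕ => (0 : ℝ)) = 0 := by
    ext
    simp
  by_cases h : ∀ i, Even (k i)
  · simp only [if_pos (h _), if_pos h]
    rfl
  · rw [if_neg h]
    obtain ⟨i, hi⟩ := not_forall.1 h
    fin_cases i
    · simp only [Fin.zero_eta] at hi
      simp only [if_neg hi, hz, zero_mul, map_zero]
    · simp only [Fin.mk_one] at hi
      simp only [if_neg hi, hz, zero_mul, mul_zero, map_zero]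
    · simp only [Fin.reduceFinMk] at hi
      simp only [if_neg hi, hz, mul_zero, map_zero]

/-! ### The polar measure -/

section Polar

variable {c : ℝ}

lemma continuous_cNorm (hc : 0 < c) : Continuous (cNorm c) := by
  unfold cNorm
  refine (Real.continuous_rpow_const (by positivity)).comp (continuous_finsetSum _ fun i _ => ?_)
  exact (Real.continuous_rpow_const hc.le).comp (by fun_prop)

lemma cNorm_smul (hc : 0 < c) {r : ℝ} (hr : 0 ≤ r) (x : Fin 3 → ℝ) :
    cNorm c (r • x) = r * cNorm c x := by
  have h : ∑ i, |(r • x) i| ^ c = r ^ c * ∑ i, |x i| ^ c := by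
    rw [Finset.mul_sum]
    refine Finset.sum_congr rfl fun i _ => ?_
    rw [Pi.smul_apply, smul_eq_mul, abs_mul, abs_of_nonneg hr, Real.mul_rpow hr (abs_nonneg _)]
  rw [cNorm, h, Real.mul_rpow (by positivity) (by positivity), ← Real.rpow_mul hr,
    mul_one_div_cancel hc.ne', Real.rpow_one, cNorm]

lemma sum_abs_rpow_of_mem_cSphere (hc : 0 < c) {y : Fin 3 → ℝ} (hy : y ∈ cSphere c) :
    ∑ i, |y i| ^ c = 1 := by
  have h1 : (∑ i, |y i| ^ c) ^ (1 / c) = 1 := hy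
  have h2 : 0 ≤ ∑ i, |y i| ^ c := by positivity
  calc ∑ i, |y i| ^ c = ((∑ i, |y i| ^ c) ^ (1 / c)) ^ c := by
        rw [← Real.rpow_mul h2, one_div_mul_cancel hc.ne', Real.rpow_one]
    _ = 1 := by rw [h1, Real.one_rpow]

/-- The exponent `c` as an extended nonnegative real. -/
noncomputable def cExp (c : ℝ) : ℝ≥0∞ := ENNReal.ofReal c

lemma cExp_toReal (hc : 0 < c) : (cExp c).toReal = c := ENNReal.toReal_ofReal hc.le

lemma norm_toLp_eq_cNorm (hc : 0 < c) (x : PiLp (cExp c) (fun _ : Fin 3 => ℝ)) :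
    ‖x‖ = cNorm c x.ofLp := by
  rw [PiLp.norm_eq_sum (by rwa [cExp_toReal hc]), cExp_toReal hc]
  rfl

/-- Lebesgue measure on `ℝ³` with the `ℓ^c` norm. -/
noncomputable def lpVolume (c : ℝ) [Fact (1 ≤ cExp c)] :
    Measure (PiLp (cExp c) (fun _ : Fin 3 => ℝ)) :=
  (volume : Measure (Fin 3 → ℝ)).map (PiLp.continuousLinearEquiv (cExp c) ℝ (fun _ => ℝ)).symm

instance [Fact (1 ≤ cExp c)] : (lpVolume c).IsAddHaarMeasure := by
  unfold lpVolume
  infer_instance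

lemma finrank_lp [Fact (1 ≤ cExp c)] :
    Module.finrank ℝ (PiLp (cExp c) (fun _ : Fin 3 => ℝ)) = 3 := by
  rw [(PiLp.continuousLinearEquiv (cExp c) ℝ (fun _ : Fin 3 => ℝ)).toLinearEquiv.finrank_eq]
  simp

/-- Integration in polar coordinates with respect to any norm. -/
lemma lintegral_polar {E : Type*} [NormedAddCommGroup E] [NormedSpace ℝ E] [MeasurableSpace E]
    [BorelSpace E] [FiniteDimensional ℝ E] [Nontrivial E] (m : Measure E) [m.IsAddHaarMeasure]
    {f : E → ℝ≥0∞} (hf : Measurable f) :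
    ∫⁻ x, f x ∂m = ∫⁻ r in Ioi (0 : ℝ), ENNReal.ofReal (r ^ (Module.finrank ℝ E - 1)) *
      ∫⁻ y : Metric.sphere (0 : E) 1, f (r • (y : E)) ∂m.toSphere := by
  have h1 : ∫⁻ x, f x ∂m = ∫⁻ x : ({0}ᶜ : Set E), f x ∂(m.comap (↑)) := by
    rw [lintegral_subtype_comap (measurableSet_singleton _).compl, restrict_compl_singleton]
  have hg : Measurable fun z : Metric.sphere (0 : E) 1 × Ioi (0 : ℝ) => f ((z.2 : ℝ) • (z.1 : E)) := by
    apply hf.comp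
    fun_prop
  have h2 := m.measurePreserving_homeomorphUnitSphereProd.lintegral_comp hg
  have h3 : ∀ x : ({0}ᶜ : Set E),
      f (((homeomorphUnitSphereProd E x).2 : ℝ) • ((homeomorphUnitSphereProd E x).1 : E)) = f x := by
    intro x
    have hx : ‖(x : E)‖ ≠ 0 := norm_ne_zero_iff.2 x.2
    simp [smul_smul, mul_inv_cancel₀ hx]
  simp only [h3] at h2
  rw [h1, h2, lintegral_prod_symm' _ hg, Measure.volumeIoiPow,
    lintegral_withDensity_eq_lintegral_mul _ (by fun_prop)
      (Measurable.lintegral_prod_left' (f := fun z : Metric.sphere (0 : E) 1 × Ioi (0 : ℝ) =>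
        f ((z.2 : ℝ) • (z.1 : E))) hg)]
  exact lintegral_subtype_comap measurableSet_Ioi (fun r : ℝ =>
    ENNReal.ofReal (r ^ (Module.finrank ℝ E - 1)) *
      ∫⁻ y : Metric.sphere (0 : E) 1, f (r • (y : E)) ∂m.toSphere)

/-- For `c ≥ 1` the function `cNorm c` is the `ℓ^c` norm, so polar integration for a general norm
applies; the sphere measure is carried to `cSphere c` by the identity on coordinates. -/
lemma exists_isPolarMeasure (hc : 1 ≤ c) : ∃ μ : Measure (cSphere c), IsPolarMeasure c μ := by
  have hc0 : 0 < c := by linarith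
  have : Fact (1 ≤ cExp c) := ⟨by rw [cExp]; exact ENNReal.one_le_ofReal.2 hc⟩
  let E := PiLp (cExp c) (fun _ : Fin 3 => ℝ)
  let φ : Metric.sphere (0 : E) 1 → cSphere c := fun y => ⟨(y : E).ofLp, by
    have h : ‖(y : E)‖ = 1 := norm_eq_of_mem_sphere y
    rwa [norm_toLp_eq_cNorm hc0] at h⟩
  have hφ : Measurable φ :=
    ((WithLp.measurable_ofLp _ _).comp measurable_subtype_coe).subtype_mk
  have : Nontrivial E := Module.nontrivial_of_finrank_pos (R := ℝ) (by rw [finrank_lp]; norm_num)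
  refine ⟨(lpVolume c).toSphere.map φ, fun f hf => ?_⟩
  have hfE : Measurable fun x : E => f x.ofLp := hf.comp (WithLp.measurable_ofLp _ _)
  have h1 := lintegral_polar (lpVolume c) hfE
  have h2 : ∫⁻ x, f (WithLp.ofLp x) ∂(lpVolume c) = ∫⁻ x, f x := by
    rw [lpVolume, lintegral_map hfE (ContinuousLinearEquiv.continuous _).measurable]
    rfl
  rw [← h2, h1, finrank_lp]
  refine lintegral_congr fun r => ?_
  rw [lintegral_map (f := fun y : cSphere c => f (r • (y : Fin 3 → ℝ)))
    (hf.comp (measurable_subtype_coe.const_smul r)) hφ]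
  rfl

lemma lintegral_sq_unit_interval :
    ∫⁻ r in Ioc (0 : ℝ) 1, ENNReal.ofReal (r ^ 2) = ENNReal.ofReal (1 / 3) := by
  rw [← ofReal_integral_eq_lintegral_ofReal, ← intervalIntegral.integral_of_le zero_le_one]
  · norm_num
  · exact (continuous_pow 2).integrableOn_Ioc
  · exact Eventually.of_forall fun r => sq_nonneg r

/-- Testing on the indicator of the truncated cone `{|x|_c ≤ 1, x / |x|_c ∈ B}` recovers one third
of the mass of `B` from a Lebesgue integral that does not involve the measure. -/
lemma IsPolarMeasure.unique (hc : 0 < c) {μ μ' : Measure (cSphere c)} (h : IsPolarMeasure c μ)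
    (h' : IsPolarMeasure c μ') : μ = μ' := by
  have hN := (continuous_cNorm hc).measurable
  have key : ∀ m : Measure (cSphere c), IsPolarMeasure c m → ∀ B : Set (Fin 3 → ℝ),
      MeasurableSet B → ∫⁻ x : Fin 3 → ℝ, (Iic (1 : ℝ)).indicator (fun _ => (1 : ℝ≥0∞)) (cNorm c x)
        * B.indicator (fun _ => (1 : ℝ≥0∞)) ((cNorm c x)⁻¹ • x)
      = ENNReal.ofReal (1 / 3) * m (Subtype.val ⁻¹' B) := by
    intro m hm B hB
    set F : (Fin 3 → ℝ) → ℝ≥0∞ := fun x =>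
      (Iic (1 : ℝ)).indicator (fun _ => (1 : ℝ≥0∞)) (cNorm c x)
        * B.indicator (fun _ => (1 : ℝ≥0∞)) ((cNorm c x)⁻¹ • x) with hF
    have hFm : Measurable F :=
      ((measurable_const.indicator measurableSet_Iic).comp hN).mul
        ((measurable_const.indicator hB).comp (hN.inv.smul measurable_id))
    have hB' : MeasurableSet (Subtype.val ⁻¹' B : Set (cSphere c)) := measurable_subtype_coe hB
    rw [hm F hFm, setLIntegral_congr_fun (g := fun r => (Iic (1 : ℝ)).indicator
      (fun r => ENNReal.ofReal (r ^ 2)) r * m (Subtype.val ⁻¹' B)) measurableSet_Ioi,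
      lintegral_mul_const _ ((by fun_prop : Measurable fun r : ℝ =>
        ENNReal.ofReal (r ^ 2)).indicator measurableSet_Iic), lintegral_indicator measurableSet_Iic,
      Measure.restrict_restrict measurableSet_Iic, inter_comm, Ioi_inter_Iic,
      lintegral_sq_unit_interval]
    intro r hr
    have hr0 : (0 : ℝ) < r := hr
    have h1 : ∀ y : cSphere c, F (r • (y : Fin 3 → ℝ))
        = (Iic (1 : ℝ)).indicator (fun _ => (1 : ℝ≥0∞)) r
          * (Subtype.val ⁻¹' B : Set (cSphere c)).indicator 1 y := by
      intro y
      have hy : cNorm c y = 1 := y.2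
      simp only [hF]
      rw [cNorm_smul hc hr0.le, hy, mul_one, smul_smul, inv_mul_cancel₀ hr0.ne', one_smul]
      rfl
    simp only [h1]
    rw [lintegral_const_mul _ (measurable_one.indicator hB'), lintegral_indicator_one hB', ← mul_assoc]
    congr 1
    by_cases h : r ∈ Iic (1 : ℝ)
    · simp [h]
    · simp [h]
  ext A hA
  obtain ⟨B, hB, rfl⟩ := hA
  have h1 := (key μ h B hB).symm.trans (key μ' h' B hB)
  exact (ENNReal.mul_right_inj (by simp) (by simp)).1 h1

end Polar

/-! ### Moments of the polar measure -/

section Moments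

variable {c : ℝ}

lemma integral_abs_rpow_mul_exp (hc : 0 < c) {s : ℝ} (hs : 0 ≤ s) :
    ∫ t : ℝ, |t| ^ s * Real.exp (-|t| ^ c) = 2 / c * Real.Gamma ((s + 1) / c) := by
  rw [integral_comp_abs (f := fun t => t ^ s * Real.exp (-t ^ c)),
    integral_rpow_mul_exp_neg_rpow hc (by linarith)]
  ring

lemma lintegral_prod_abs_rpow_mul_exp (hc : 0 < c) {s : Fin 3 → ℝ} (hs : ∀ i, 0 ≤ s i) :
    ∫⁻ x : Fin 3 → ℝ, ENNReal.ofReal (∏ i, |x i| ^ s i * Real.exp (-|x i| ^ c))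
      = ENNReal.ofReal (∏ i, 2 / c * Real.Gamma ((s i + 1) / c)) := by
  have h1 : ∫ x : Fin 3 → ℝ, ∏ i, |x i| ^ s i * Real.exp (-|x i| ^ c)
      = ∏ i, 2 / c * Real.Gamma ((s i + 1) / c) := by
    rw [integral_fintype_prod_volume_eq_prod
      (f := fun (i : Fin 3) (t : ℝ) => |t| ^ s i * Real.exp (-|t| ^ c))]
    exact Finset.prod_congr rfl fun i _ => integral_abs_rpow_mul_exp hc (hs i)
  have hpos : 0 < ∏ i, 2 / c * Real.Gamma ((s i + 1) / c) := by
    refine Finset.prod_pos fun i _ => ?_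
    have : 0 < (s i + 1) / c := div_pos (by linarith [hs i]) hc
    have := Real.Gamma_pos_of_pos this
    positivity
  rw [← h1, ofReal_integral_eq_lintegral_ofReal]
  -- A non-integrable function would have integral `0` by convention, contradicting the positive
  -- value already computed.
  · by_contra h
    rw [integral_undef h] at h1
    exact hpos.ne h1
  · exact Eventually.of_forall fun x => Finset.prod_nonneg fun i _ => by positivity

/-- The integral of `∏ |x_i|^(s_i) exp(-|x_i|^c)` is evaluated in two ways. On the ray through a
sphere point the exponentials multiply to `exp(-r^c)`, so the radial integral splits off as a Gamma
value. -/
lemma IsPolarMeasure.lintegral_prod_abs_rpow (hc : 0 < c) {μ : Measure (cSphere c)}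
    (h : IsPolarMeasure c μ) {s : Fin 3 → ℝ} (hs : ∀ i, 0 ≤ s i) :
    ENNReal.ofReal (1 / c * Real.Gamma ((∑ i, s i + 3) / c))
      * ∫⁻ y : cSphere c, ENNReal.ofReal (∏ i, |(y : Fin 3 → ℝ) i| ^ s i) ∂μ
      = ENNReal.ofReal (∏ i, 2 / c * Real.Gamma ((s i + 1) / c)) := by
  have hS : 0 ≤ ∑ i, s i := Finset.sum_nonneg fun i _ => hs i
  have hm : Measurable fun x : Fin 3 → ℝ =>
      ENNReal.ofReal (∏ i, |x i| ^ s i * Real.exp (-|x i| ^ c)) := by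
    fun_prop
  rw [← lintegral_prod_abs_rpow_mul_exp hc hs, h _ hm]
  have hpt : ∀ r ∈ Ioi (0 : ℝ), ∀ y : cSphere c,
      ∏ i, |(r • (y : Fin 3 → ℝ)) i| ^ s i * Real.exp (-|(r • (y : Fin 3 → ℝ)) i| ^ c)
        = r ^ (∑ i, s i) * Real.exp (-r ^ c) * ∏ i, |(y : Fin 3 → ℝ) i| ^ s i := by
    intro r hr y
    have hr0 : (0 : ℝ) < r := hr
    have e1 : ∀ i, |(r • (y : Fin 3 → ℝ)) i| ^ s i * Real.exp (-|(r • (y : Fin 3 → ℝ)) i| ^ c)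
        = (r ^ s i * |(y : Fin 3 → ℝ) i| ^ s i) * Real.exp (-(r ^ c * |(y : Fin 3 → ℝ) i| ^ c)) := by
      intro i
      rw [Pi.smul_apply, smul_eq_mul, abs_mul, abs_of_pos hr0,
        Real.mul_rpow hr0.le (abs_nonneg _), Real.mul_rpow hr0.le (abs_nonneg _)]
    rw [Finset.prod_congr rfl fun i _ => e1 i, Finset.prod_mul_distrib, Finset.prod_mul_distrib,
      ← Real.exp_sum, Finset.sum_neg_distrib, ← Finset.mul_sum,
      sum_abs_rpow_of_mem_cSphere hc y.2, mul_one, Real.rpow_sum_of_pos hr0]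
    ring
  have hm2 : Measurable fun y : cSphere c => ENNReal.ofReal (∏ i, |(y : Fin 3 → ℝ) i| ^ s i) := by
    have : Measurable fun x : Fin 3 → ℝ => ENNReal.ofReal (∏ i, |x i| ^ s i) := by fun_prop
    exact this.comp measurable_subtype_coe
  rw [setLIntegral_congr_fun (g := fun r => ENNReal.ofReal (r ^ (∑ i, s i + 2) * Real.exp (-r ^ c))
      * ∫⁻ y : cSphere c, ENNReal.ofReal (∏ i, |(y : Fin 3 → ℝ) i| ^ s i) ∂μ) measurableSet_Ioi,
    lintegral_mul_const _ (by fun_prop), ← ofReal_integral_eq_lintegral_ofReal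
      (f := fun r : ℝ => r ^ (∑ i, s i + 2) * Real.exp (-r ^ c)),
    integral_rpow_mul_exp_neg_rpow hc (by linarith)]
  · congr 4
    ring
  · exact integrableOn_rpow_mul_exp_neg_rpow (by linarith) hc
  · filter_upwards [ae_restrict_mem measurableSet_Ioi] with r hr
    have : (0 : ℝ) < r := hr
    positivity
  · intro r hr
    have hr0 : (0 : ℝ) < r := hr
    simp only [hpt r hr]
    have hn : 0 ≤ r ^ (∑ i, s i) * Real.exp (-r ^ c) := by positivity
    simp only [ENNReal.ofReal_mul hn]
    rw [lintegral_const_mul _ hm2, ← mul_assoc, ← ENNReal.ofReal_mul (by positivity)]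
    congr 2
    rw [Real.rpow_add hr0, Real.rpow_two]
    ring

/-- The moments of the polar measure. -/
noncomputable def polarMoment (a : ℝ) (k : Fin 3 → ℕ) : ℝ :=
  8 * a ^ 2 * (Real.Gamma (a + k 0) * Real.Gamma (a + k 1) * Real.Gamma (a + k 2))
    / Real.Gamma (3 * a + (k 0 + k 1 + k 2 : ℕ))

lemma polarMoment_pos {a : ℝ} (ha : 0 < a) (k : Fin 3 → ℕ) : 0 < polarMoment a k := by
  have h : ∀ m : ℕ, 0 < Real.Gamma (a + m) := fun m => Real.Gamma_pos_of_pos (by positivity)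
  have h3 : 0 < Real.Gamma (3 * a + (k 0 + k 1 + k 2 : ℕ)) := Real.Gamma_pos_of_pos (by positivity)
  have h0 := h (k 0)
  have h1 := h (k 1)
  have h2 := h (k 2)
  unfold polarMoment
  positivity

/-- The exponents `s_i = c k_i` turn `(s_i + 1) / c` into `1/c + k_i`, the Gamma arguments occurring
in `tendsto_weightedCount`. -/
lemma IsPolarMeasure.lintegral_moment (hc : 0 < c) {μ : Measure (cSphere c)}
    (h : IsPolarMeasure c μ) (k : Fin 3 → ℕ) :
    ∫⁻ y : cSphere c, ENNReal.ofReal (∏ i, |(y : Fin 3 → ℝ) i| ^ (c * k i)) ∂μ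
      = ENNReal.ofReal (polarMoment (1 / c) k) := by
  have h1 := h.lintegral_prod_abs_rpow hc (s := fun i => c * k i) (fun i => by positivity)
  have hG : 0 < Real.Gamma (3 * (1 / c) + (k 0 + k 1 + k 2 : ℕ)) :=
    Real.Gamma_pos_of_pos (by positivity)
  have e1 : (∑ i, c * (k i : ℝ) + 3) / c = 3 * (1 / c) + (k 0 + k 1 + k 2 : ℕ) := by
    rw [Fin.sum_univ_three]
    push_cast
    field_simp
    ring
  have e2 : ∀ i, (c * (k i : ℝ) + 1) / c = 1 / c + k i := by
    intro i
    field_simp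
    ring
  have e3 : ∏ i, 2 / c * Real.Gamma ((c * (k i : ℝ) + 1) / c)
      = 1 / c * Real.Gamma (3 * (1 / c) + (k 0 + k 1 + k 2 : ℕ)) * polarMoment (1 / c) k := by
    rw [Fin.prod_univ_three, e2, e2, e2, polarMoment]
    field_simp
    ring
  have hp : 0 < 1 / c * Real.Gamma (3 * (1 / c) + (k 0 + k 1 + k 2 : ℕ)) := by positivity
  rw [e1, e3, ENNReal.ofReal_mul hp.le] at h1
  exact (ENNReal.mul_right_inj (ENNReal.ofReal_pos.2 hp).ne' ENNReal.ofReal_ne_top).1 h1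

lemma IsPolarMeasure.measure_univ (hc : 0 < c) {μ : Measure (cSphere c)}
    (h : IsPolarMeasure c μ) : μ univ = ENNReal.ofReal (polarMoment (1 / c) 0) := by
  rw [← h.lintegral_moment hc 0]
  simp

/-! ### Reflection symmetry and signed moments. -/

/-- The reflection of the `i`-th coordinate. -/
def reflect (i : Fin 3) (x : Fin 3 → ℝ) : Fin 3 → ℝ := fun j => if j = i then -x j else x j

lemma abs_reflect (i j : Fin 3) (x : Fin 3 → ℝ) : |reflect i x j| = |x j| := by
  rw [reflect]
  split_ifs
  · exact abs_neg _
  · rfl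

lemma reflect_smul (i : Fin 3) (r : ℝ) (x : Fin 3 → ℝ) : reflect i (r • x) = r • reflect i x := by
  ext j
  simp only [reflect, Pi.smul_apply, smul_eq_mul]
  split_ifs <;> ring

lemma measurePreserving_reflect (i : Fin 3) : MeasurePreserving (reflect i) := by
  refine volume_preserving_pi (f := fun j (t : ℝ) => if j = i then -t else t) fun j => ?_
  by_cases h : j = i
  · simp only [if_pos h]
    exact Measure.measurePreserving_neg volume
  · simp only [if_neg h]
    exact MeasurePreserving.id _

/-- The reflection of the `i`-th coordinate, on the sphere. -/
def sphereReflect (c : ℝ) (i : Fin 3) (y : cSphere c) : cSphere c :=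
  ⟨reflect i y, by
    have h : cNorm c y = 1 := y.2
    change cNorm c _ = 1
    rw [← h]
    simp only [cNorm, abs_reflect]⟩

lemma measurable_sphereReflect (i : Fin 3) : Measurable (sphereReflect c i) :=
  ((measurePreserving_reflect i).measurable.comp measurable_subtype_coe).subtype_mk

/-- Reflections preserve Lebesgue measure, so the pushforward is again a polar measure, and
uniqueness applies. -/
lemma IsPolarMeasure.map_sphereReflect (hc : 0 < c) {μ : Measure (cSphere c)}
    (h : IsPolarMeasure c μ) (i : Fin 3) : μ.map (sphereReflect c i) = μ := by
  refine IsPolarMeasure.unique hc (fun f hf => ?_) h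
  have hr := measurePreserving_reflect i
  rw [← hr.lintegral_comp hf, h (fun x => f (reflect i x)) (hf.comp hr.measurable)]
  refine lintegral_congr fun r => ?_
  rw [lintegral_map (f := fun y : cSphere c => f (r • (y : Fin 3 → ℝ)))
    (hf.comp (measurable_subtype_coe.const_smul r)) (measurable_sphereReflect i)]
  simp only [reflect_smul]
  rfl

/-- The odd extension of `t ↦ t ^ c`. -/
noncomputable def signedPow (c t : ℝ) : ℝ := (max t 0) ^ c - (max (-t) 0) ^ c

lemma continuous_signedPow (hc : 0 < c) : Continuous (signedPow c) := by
  unfold signedPow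
  exact ((Real.continuous_rpow_const hc.le).comp (by fun_prop)).sub
    ((Real.continuous_rpow_const hc.le).comp (by fun_prop))

lemma signedPow_neg (c t : ℝ) : signedPow c (-t) = -signedPow c t := by
  rw [signedPow, signedPow, neg_neg]
  ring

lemma signedPow_of_nonneg (hc : 0 < c) {t : ℝ} (ht : 0 ≤ t) : signedPow c t = t ^ c := by
  rw [signedPow, max_eq_left ht, max_eq_right (by linarith), Real.zero_rpow hc.ne', sub_zero]

lemma abs_signedPow (hc : 0 < c) (t : ℝ) : |signedPow c t| = |t| ^ c := by
  rcases le_total 0 t with h | h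
  · rw [signedPow_of_nonneg hc h, abs_of_nonneg (Real.rpow_nonneg h _), abs_of_nonneg h]
  · have h' : 0 ≤ -t := by linarith
    rw [← abs_neg (signedPow c t), ← signedPow_neg, signedPow_of_nonneg hc h',
      abs_of_nonneg (Real.rpow_nonneg h' _), abs_of_nonpos h]

lemma signedPow_signedPow (hc : 0 < c) (t : ℝ) : signedPow (1 / c) (signedPow c t) = t := by
  have key : ∀ t : ℝ, 0 ≤ t → signedPow (1 / c) (signedPow c t) = t := by
    intro t ht
    rw [signedPow_of_nonneg hc ht, signedPow_of_nonneg (by positivity) (Real.rpow_nonneg ht _),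
      ← Real.rpow_mul ht, mul_one_div_cancel hc.ne', Real.rpow_one]
  rcases le_total 0 t with h | h
  · exact key t h
  · have h1 := key (-t) (by linarith)
    rw [signedPow_neg, signedPow_neg] at h1
    linarith

/-- An odd exponent makes the integrand change sign under a reflection preserving the measure. The
dichotomy is that of `sum_signedFloor_monomial`. -/
lemma IsPolarMeasure.integral_monomial (hc : 0 < c) {μ : Measure (cSphere c)}
    (h : IsPolarMeasure c μ) (k : Fin 3 → ℕ) :
    ∫ y : cSphere c, ∏ i, signedPow c ((y : Fin 3 → ℝ) i) ^ k i ∂μ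
      = if ∀ i, Even (k i) then polarMoment (1 / c) k else 0 := by
  have hcont : Continuous fun y : cSphere c => ∏ i, signedPow c ((y : Fin 3 → ℝ) i) ^ k i :=
    continuous_finsetProd _ fun i _ => ((continuous_signedPow hc).comp
      ((continuous_apply i).comp continuous_subtype_val)).pow _
  split_ifs with hk
  · have e : ∀ y : cSphere c, ∏ i, signedPow c ((y : Fin 3 → ℝ) i) ^ k i
        = ∏ i, |(y : Fin 3 → ℝ) i| ^ (c * k i) := by
      intro y
      refine Finset.prod_congr rfl fun i _ => ?_
      rw [← (hk i).pow_abs, abs_signedPow hc, ← Real.rpow_mul_natCast (abs_nonneg _)]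
    rw [integral_eq_lintegral_of_nonneg_ae _ hcont.aestronglyMeasurable]
    · simp only [e]
      rw [h.lintegral_moment hc, ENNReal.toReal_ofReal (polarMoment_pos (by positivity) k).le]
    · exact Eventually.of_forall fun y => Finset.prod_nonneg fun i _ => (hk i).pow_nonneg _
  · obtain ⟨i, hi⟩ := not_forall.1 hk
    have h1 : ∫ y : cSphere c, ∏ j, signedPow c ((y : Fin 3 → ℝ) j) ^ k j ∂μ
        = ∫ y : cSphere c, ∏ j, signedPow c (reflect i (y : Fin 3 → ℝ) j) ^ k j ∂μ := by
      conv_lhs => rw [← h.map_sphereReflect hc i]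
      rw [integral_map (measurable_sphereReflect i).aemeasurable hcont.aestronglyMeasurable]
      rfl
    have h2 : ∀ y : cSphere c, ∏ j, signedPow c (reflect i (y : Fin 3 → ℝ) j) ^ k j
        = -∏ j, signedPow c ((y : Fin 3 → ℝ) j) ^ k j := by
      intro y
      rw [← Finset.mul_prod_erase _ _ (Finset.mem_univ i),
        ← Finset.mul_prod_erase _ (fun j => signedPow c ((y : Fin 3 → ℝ) j) ^ k j)
          (Finset.mem_univ i), ← neg_mul]
      congr 1
      · rw [reflect, if_pos rfl, signedPow_neg, (Nat.not_even_iff_odd.1 hi).neg_pow]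
      · refine Finset.prod_congr rfl fun j hj => ?_
        rw [reflect, if_neg (Finset.ne_of_mem_erase hj)]
    simp only [h2, integral_neg] at h1
    linarith

end Moments

/-! ### Equidistribution -/

section Equidistribution

variable {c : ℝ}

lemma abs_rpow_le_one_of_mem_cSphere (hc : 0 < c) {y : Fin 3 → ℝ} (hy : y ∈ cSphere c) (i : Fin 3) :
    |y i| ^ c ≤ 1 := by
  rw [← sum_abs_rpow_of_mem_cSphere hc hy]
  exact Finset.single_le_sum (f := fun i => |y i| ^ c) (fun j _ => by positivity)
    (Finset.mem_univ i)

lemma compactSpace_cSphere (hc : 0 < c) : CompactSpace (cSphere c) := by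
  rw [← isCompact_iff_compactSpace]
  refine (isCompact_Icc (a := fun _ : Fin 3 => (-1 : ℝ)) (b := fun _ => 1)).of_isClosed_subset
    (isClosed_eq (continuous_cNorm hc) continuous_const) fun y hy => ?_
  have h : ∀ i, |y i| ≤ 1 := by
    intro i
    by_contra hlt
    exact absurd (abs_rpow_le_one_of_mem_cSphere hc hy i)
      (not_le.2 (Real.one_lt_rpow (not_le.1 hlt) hc))
  exact ⟨fun i => (abs_le.1 (h i)).1, fun i => (abs_le.1 (h i)).2⟩

lemma IsPolarMeasure.isProbabilityMeasure_normalized (hc : 0 < c) {μ : Measure (cSphere c)}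
    (h : IsPolarMeasure c μ) : IsProbabilityMeasure (normalized μ) := by
  have hpos := polarMoment_pos (a := 1 / c) (by positivity) 0
  refine ⟨?_⟩
  rw [normalized, Measure.smul_apply, smul_eq_mul, h.measure_univ hc]
  exact ENNReal.inv_mul_cancel (ENNReal.ofReal_pos.2 hpos).ne' ENNReal.ofReal_ne_top

lemma IsPolarMeasure.integral_normalized (hc : 0 < c) {μ : Measure (cSphere c)}
    (h : IsPolarMeasure c μ) (f : cSphere c → ℝ) :
    ∫ y, f y ∂(normalized μ) = (polarMoment (1 / c) 0)⁻¹ * ∫ y, f y ∂μ := by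
  have hpos := polarMoment_pos (a := 1 / c) (by positivity) 0
  rw [normalized, integral_smul_measure, h.measure_univ hc, ENNReal.toReal_inv,
    ENNReal.toReal_ofReal hpos.le, smul_eq_mul]

lemma card_arithSphereFinset (hc : 1 ≤ c) (N : ℕ) :
    (arithSphereFinset hc N).card = latticeCount c N := by
  rw [latticeCount, Set.ncard_eq_toFinset_card _ (arithSphere_finite hc N), arithSphereFinset]

/-- The average of a function over the arithmetic sphere. -/
noncomputable def sphereAvg (hc : 1 ≤ c) (N : ℕ) (g : (Fin 3 → ℤ) → ℝ) : ℝ :=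
  (latticeCount c N : ℝ)⁻¹ * ∑ x ∈ arithSphereFinset hc N, g x

lemma abs_sphereAvg_sub_le (hc : 1 ≤ c) (N : ℕ) {g g' : (Fin 3 → ℤ) → ℝ} {ε : ℝ} (hε : 0 ≤ ε)
    (h : ∀ x ∈ arithSphereFinset hc N, |g x - g' x| ≤ ε) :
    |sphereAvg hc N g - sphereAvg hc N g'| ≤ ε := by
  rw [sphereAvg, sphereAvg, ← mul_sub, ← Finset.sum_sub_distrib, abs_mul, abs_inv, Nat.abs_cast,
    ← card_arithSphereFinset hc]
  have h1 : |∑ x ∈ arithSphereFinset hc N, (g x - g' x)| ≤ (arithSphereFinset hc N).card * ε := by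
    refine (Finset.abs_sum_le_sum_abs _ _).trans ?_
    rw [← nsmul_eq_mul]
    exact Finset.sum_le_card_nsmul _ _ _ h
  -- On an empty sphere both averages are `0`, since the inverse of `0` is `0`.
  rcases Nat.eq_zero_or_pos (arithSphereFinset hc N).card with h0 | h0
  · simp [h0, hε]
  · have h0' : (0 : ℝ) < (arithSphereFinset hc N).card := by exact_mod_cast h0
    rw [inv_mul_le_iff₀ h0']
    exact h1

lemma natCast_latticeCount (hc : 1 ≤ c) (N : ℕ) :
    (latticeCount c N : ℝ) = weightedCount (1 / c) 0 N := by
  have h := sum_signedFloor_monomial hc N 0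
  rw [if_pos (by simp)] at h
  rw [← h, ← card_arithSphereFinset hc]
  simp

lemma tendsto_weightedCount_div (hc1 : 1 < c) (hc2 : c < 9 / 8) (k : Fin 3 → ℕ) :
    Tendsto (fun N : ℕ => weightedCount (1 / c) k N
        / (N : ℝ) ^ (3 * (1 / c) + (k 0 + k 1 + k 2 : ℕ) - 1)) atTop
      (𝓝 (1 / c * polarMoment (1 / c) k)) := by
  have hc0 : 0 < c := by linarith
  have ha0 : 8 / 9 < 1 / c := by rw [lt_div_iff₀ hc0]; linarith
  have ha1 : 1 / c < 1 := by rw [div_lt_one hc0]; exact hc1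
  convert! tendsto_weightedCount ha0 ha1 k using 2
  rw [polarMoment]
  ring

/-- Numerator and cardinality are the weighted counts for `k` and for `0`; the factor `1/c` cancels
in the quotient of their limits. -/
lemma tendsto_sphereAvg_monomial (hc1 : 1 < c) (hc2 : c < 9 / 8) (k : Fin 3 → ℕ) :
    Tendsto (fun N : ℕ => sphereAvg hc1.le N fun x => ∏ i, (signedFloor c (x i) / N) ^ k i) atTop
      (𝓝 ((polarMoment (1 / c) 0)⁻¹ * if ∀ i, Even (k i) then polarMoment (1 / c) k else 0)) := by
  have hc0 : 0 < c := by linarith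
  have hsum : ∀ N : ℕ, ∑ x ∈ arithSphereFinset hc1.le N, ∏ i, (signedFloor c (x i) / N) ^ k i
      = (if ∀ i, Even (k i) then weightedCount (1 / c) k N else 0)
        / (N : ℝ) ^ (k 0 + k 1 + k 2) := by
    intro N
    rw [← sum_signedFloor_monomial hc1.le, Finset.sum_div]
    refine Finset.sum_congr rfl fun x _ => ?_
    simp only [div_pow]
    rw [Finset.prod_div_distrib, Finset.prod_pow_eq_pow_sum, Fin.sum_univ_three]
  simp only [sphereAvg, hsum]
  split_ifs with hk
  · have hM := polarMoment_pos (a := 1 / c) (by positivity) 0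
    have h0 := tendsto_weightedCount_div hc1 hc2 0
    have h1 := tendsto_weightedCount_div hc1 hc2 k
    have h2 := h1.div h0 (by positivity)
    have e : 1 / c * polarMoment (1 / c) k / (1 / c * polarMoment (1 / c) 0)
        = (polarMoment (1 / c) 0)⁻¹ * polarMoment (1 / c) k := by
      field_simp
    rw [e] at h2
    refine h2.congr' ?_
    filter_upwards [eventually_gt_atTop 0] with N hN
    have hNR : (0 : ℝ) < N := by exact_mod_cast hN
    have hp : 0 < (N : ℝ) ^ (3 * (1 / c) - 1) := Real.rpow_pos_of_pos hNR _
    simp only [Pi.div_apply, Pi.zero_apply, add_zero, Nat.cast_zero]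
    rw [natCast_latticeCount hc1.le,
      show 3 * (1 / c) + ((k 0 + k 1 + k 2 : ℕ) : ℝ) - 1 = 3 * (1 / c) - 1 + (k 0 + k 1 + k 2 : ℕ) by
        ring, Real.rpow_add hNR, Real.rpow_natCast]
    field_simp
  · simp

/-! ### Passage from monomials to continuous functions. -/

/-- The compact cube `[-2, 2]³`. -/
def cube : Set (Fin 3 → ℝ) := Icc (fun _ => -2) (fun _ => 2)

lemma mem_cube {u : Fin 3 → ℝ} (h : ∀ i, |u i| ≤ 2) : u ∈ cube :=
  ⟨fun i => (abs_le.1 (h i)).1, fun i => (abs_le.1 (h i)).2⟩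

lemma isCompact_cube : IsCompact cube := isCompact_Icc

/-- The coordinate functions on a set. -/
def coordMap (K : Set (Fin 3 → ℝ)) (i : Fin 3) : C(K, ℝ) :=
  ⟨fun u => (u : Fin 3 → ℝ) i, (continuous_apply i).comp continuous_subtype_val⟩

lemma aeval_coordMap_apply (K : Set (Fin 3 → ℝ)) (p : MvPolynomial (Fin 3) ℝ) (u : K) :
    (MvPolynomial.aeval (coordMap K) p) u = MvPolynomial.eval (u : Fin 3 → ℝ) p := by
  induction p using MvPolynomial.induction_on with
  | C a => simp
  | add p q hp hq => rw [map_add, map_add, ContinuousMap.add_apply, hp, hq]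
  | mul_X p i hp =>
    rw [map_mul, map_mul, ContinuousMap.mul_apply, hp, MvPolynomial.aeval_X, MvPolynomial.eval_X]
    rfl

/-- Multivariate Weierstrass approximation. -/
lemma exists_mvPolynomial_near {K : Set (Fin 3 → ℝ)} (hK : IsCompact K) {Φ : (Fin 3 → ℝ) → ℝ}
    (hΦ : Continuous Φ) {ε : ℝ} (hε : 0 < ε) :
    ∃ p : MvPolynomial (Fin 3) ℝ, ∀ u ∈ K, |MvPolynomial.eval u p - Φ u| ≤ ε := by
  have : CompactSpace K := isCompact_iff_compactSpace.1 hK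
  have hsep : (MvPolynomial.aeval (R := ℝ) (coordMap K)).range.SeparatesPoints := by
    intro u v huv
    have h1 : (u : Fin 3 → ℝ) ≠ v := fun h => huv (Subtype.ext h)
    obtain ⟨i, hi⟩ := Function.ne_iff.1 h1
    exact ⟨coordMap K i, ⟨coordMap K i, ⟨MvPolynomial.X i, MvPolynomial.aeval_X _ _⟩, rfl⟩, hi⟩
  obtain ⟨⟨g, p, hp⟩, hg⟩ :=
    ContinuousMap.exists_mem_subalgebra_near_continuousMap_of_separatesPoints _ hsep
      (ContinuousMap.mk (fun u : K => Φ u) (hΦ.comp continuous_subtype_val)) ε hε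
  refine ⟨p, fun u hu => ?_⟩
  rw [← aeval_coordMap_apply K p ⟨u, hu⟩]
  have h1 := (ContinuousMap.norm_coe_le_norm _ (⟨u, hu⟩ : K)).trans hg.le
  have h2 : MvPolynomial.aeval (coordMap K) p = g := hp
  rw [h2]
  exact h1

lemma integrable_of_continuous (hc : 0 < c) (ν : Measure (cSphere c)) [IsFiniteMeasure ν]
    {E : Type*} [NormedAddCommGroup E] {f : cSphere c → E} (hf : Continuous f) :
    Integrable f ν := by
  have := compactSpace_cSphere hc
  exact hf.integrable_of_hasCompactSupport (HasCompactSupport.of_compactSpace f)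

lemma abs_signedFloor_div_le (hc : 1 ≤ c) {N : ℕ} (hN : 0 < N) {x : Fin 3 → ℤ}
    (hx : x ∈ arithSphereFinset hc N) (i : Fin 3) : |signedFloor c (x i) / N| ≤ 1 := by
  have hNR : (0 : ℝ) < N := by exact_mod_cast hN
  have h1 : ⌊|(x i : ℝ)| ^ c⌋ ≤ (N : ℤ) := by
    rw [← (mem_arithSphereFinset hc N x).1 hx]
    exact Finset.single_le_sum
      (f := fun i => ⌊|(x i : ℝ)| ^ c⌋) (fun j _ => Int.floor_nonneg.2 (by positivity))
      (Finset.mem_univ i)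
  have h2 : ((⌊|(x i : ℝ)| ^ c⌋ : ℤ) : ℝ) ≤ N := by exact_mod_cast h1
  have h3 : (0 : ℝ) ≤ ((⌊|(x i : ℝ)| ^ c⌋ : ℤ) : ℝ) := by
    exact_mod_cast Int.floor_nonneg.2 (by positivity)
  have h4 : |((x i).sign : ℝ)| ≤ 1 := by
    rcases Int.sign_trichotomy (x i) with h | h | h <;> simp [h]
  rw [abs_div, Nat.abs_cast, div_le_one hNR, signedFloor, abs_mul, abs_of_nonneg h3]
  nlinarith [abs_nonneg ((x i).sign : ℝ)]

lemma signedPow_mul (hc : 0 < c) {r : ℝ} (hr : 0 ≤ r) (t : ℝ) :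
    signedPow c (r * t) = r ^ c * signedPow c t := by
  have key : ∀ t : ℝ, 0 ≤ t → signedPow c (r * t) = r ^ c * signedPow c t := by
    intro t ht
    rw [signedPow_of_nonneg hc (mul_nonneg hr ht), signedPow_of_nonneg hc ht, Real.mul_rpow hr ht]
  rcases le_total 0 t with h | h
  · exact key t h
  · have h1 := key (-t) (by linarith)
    rw [mul_neg, signedPow_neg, signedPow_neg] at h1
    linarith

lemma abs_signedPow_sub_signedFloor_le (hc : 0 < c) (x : ℤ) :
    |signedPow c x - signedFloor c x| ≤ 1 := by
  have key : ∀ t : ℝ, 0 ≤ t → |t ^ c - ⌊t ^ c⌋| ≤ 1 := by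
    intro t _
    rw [abs_of_nonneg (sub_nonneg.2 (Int.floor_le _))]
    linarith [Int.lt_floor_add_one (t ^ c)]
  rcases lt_trichotomy x 0 with h | h | h
  · have hR : (0 : ℝ) ≤ -(x : ℝ) := by
      have : (x : ℝ) < 0 := by exact_mod_cast h
      linarith
    rw [signedFloor, Int.sign_eq_neg_one_of_neg h, abs_of_nonpos (by linarith : (x : ℝ) ≤ 0),
      ← neg_neg (x : ℝ), signedPow_neg, signedPow_of_nonneg hc hR, neg_neg (-(x : ℝ))]
    have := key _ hR
    rw [abs_sub_comm] at this
    convert this using 2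
    push_cast
    ring
  · subst h
    simp [signedPow, signedFloor]
  · have hR : (0 : ℝ) < (x : ℝ) := by exact_mod_cast h
    rw [signedFloor, Int.sign_eq_one_of_pos h, abs_of_pos hR, signedPow_of_nonneg hc hR.le,
      Int.cast_one, one_mul]
    exact key _ hR.le

/-- By homogeneity `signedPow c` turns the scaling `N^(-1/c)` into `1/N`, so the floor costs at most
`1/N`. -/
lemma abs_signedPow_scaled_sub_le (hc : 0 < c) {N : ℕ} (hN : 0 < N) (x : ℤ) :
    |signedPow c ((N : ℝ) ^ (-1 / c) * x) - signedFloor c x / N| ≤ 1 / N := by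
  have hNR : (0 : ℝ) < N := by exact_mod_cast hN
  have h1 : ((N : ℝ) ^ (-1 / c)) ^ c = 1 / N := by
    rw [← Real.rpow_mul hNR.le, div_mul_cancel₀ _ hc.ne', Real.rpow_neg_one, one_div]
  rw [signedPow_mul hc (by positivity), h1,
    show 1 / (N : ℝ) * signedPow c x - signedFloor c x / N
      = (signedPow c x - signedFloor c x) / N by ring, abs_div, Nat.abs_cast]
  exact div_le_div_of_nonneg_right (abs_signedPow_sub_signedFloor_le hc x) hNR.le

variable {μ : Measure (cSphere c)}

lemma IsPolarMeasure.tendsto_sphereAvg_polynomial (hc1 : 1 < c) (hc2 : c < 9 / 8)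
    (h : IsPolarMeasure c μ) (p : MvPolynomial (Fin 3) ℝ) :
    Tendsto (fun N : ℕ => sphereAvg hc1.le N
        fun x => MvPolynomial.eval (fun i => signedFloor c (x i) / N) p) atTop
      (𝓝 (∫ y : cSphere c, MvPolynomial.eval (fun i => signedPow c ((y : Fin 3 → ℝ) i)) p
        ∂(normalized μ))) := by
  have hc0 : 0 < c := by linarith
  have := h.isProbabilityMeasure_normalized hc0
  simp only [MvPolynomial.eval_eq']
  have e1 : ∀ N : ℕ, (sphereAvg hc1.le N fun x => ∑ d ∈ p.support,
      p.coeff d * ∏ i, (signedFloor c (x i) / N) ^ d i)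
      = ∑ d ∈ p.support, p.coeff d *
        sphereAvg hc1.le N fun x => ∏ i, (signedFloor c (x i) / N) ^ d i := by
    intro N
    simp only [sphereAvg]
    rw [Finset.sum_comm, Finset.mul_sum]
    refine Finset.sum_congr rfl fun d _ => ?_
    rw [← Finset.mul_sum]
    ring
  simp only [e1]
  rw [integral_finsetSum]
  · refine tendsto_finsetSum _ fun d _ => ?_
    rw [integral_const_mul, h.integral_normalized hc0, h.integral_monomial hc0]
    exact (tendsto_sphereAvg_monomial hc1 hc2 d).const_mul _
  · intro d _
    refine integrable_of_continuous hc0 _ (continuous_const.mul ?_)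
    exact continuous_finsetProd _ fun i _ => ((continuous_signedPow hc0).comp
      ((continuous_apply i).comp continuous_subtype_val)).pow _

lemma IsPolarMeasure.tendsto_sphereAvg_signedFloor (hc1 : 1 < c) (hc2 : c < 9 / 8)
    (h : IsPolarMeasure c μ) {Φ : (Fin 3 → ℝ) → ℝ} (hΦ : Continuous Φ) :
    Tendsto (fun N : ℕ => sphereAvg hc1.le N fun x => Φ (fun i => signedFloor c (x i) / N)) atTop
      (𝓝 (∫ y : cSphere c, Φ (fun i => signedPow c ((y : Fin 3 → ℝ) i)) ∂(normalized μ))) := by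
  have hc0 : 0 < c := by linarith
  have := h.isProbabilityMeasure_normalized hc0
  have hS : Continuous fun y : cSphere c => fun i => signedPow c ((y : Fin 3 → ℝ) i) :=
    continuous_pi fun i => (continuous_signedPow hc0).comp
      ((continuous_apply i).comp continuous_subtype_val)
  rw [Metric.tendsto_atTop]
  intro ε hε
  -- Replacing `Φ` by `p` costs `ε/4` in the average and `ε/4` in the integral; convergence for `p`
  -- costs a third `ε/4`.
  obtain ⟨p, hp⟩ := exists_mvPolynomial_near isCompact_cube hΦ (ε := ε / 4) (by positivity)
  obtain ⟨N₀, hN₀⟩ := (Metric.tendsto_atTop.1 (h.tendsto_sphereAvg_polynomial hc1 hc2 p)) (ε / 4)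
    (by positivity)
  refine ⟨max N₀ 1, fun N hN => ?_⟩
  have hN1 : 0 < N := le_of_max_le_right hN
  have h1 := hN₀ N (le_of_max_le_left hN)
  have h2 := abs_sphereAvg_sub_le hc1.le N
    (g := fun x => Φ (fun i => signedFloor c (x i) / N))
    (g' := fun x => MvPolynomial.eval (fun i => signedFloor c (x i) / N) p) (ε := ε / 4)
    (by positivity) (fun x hx => by
      rw [abs_sub_comm]
      exact hp _ (mem_cube fun i =>
        (abs_signedFloor_div_le hc1.le hN1 hx i).trans one_le_two))
  have h3 : |∫ y : cSphere c, MvPolynomial.eval (fun i => signedPow c ((y : Fin 3 → ℝ) i)) p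
        ∂(normalized μ)
      - ∫ y : cSphere c, Φ (fun i => signedPow c ((y : Fin 3 → ℝ) i)) ∂(normalized μ)| ≤ ε / 4 := by
    have i1 : Integrable (fun y : cSphere c =>
        MvPolynomial.eval (fun i => signedPow c ((y : Fin 3 → ℝ) i)) p) (normalized μ) :=
      integrable_of_continuous hc0 _ ((MvPolynomial.continuous_eval p).comp hS)
    have i2 : Integrable (fun y : cSphere c =>
        Φ (fun i => signedPow c ((y : Fin 3 → ℝ) i))) (normalized μ) :=
      integrable_of_continuous hc0 _ (hΦ.comp hS)
    rw [← integral_sub i1 i2]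
    have h4 := norm_integral_le_of_norm_le_const (μ := normalized μ) (C := ε / 4)
      (f := fun y : cSphere c => MvPolynomial.eval (fun i => signedPow c ((y : Fin 3 → ℝ) i)) p
        - Φ (fun i => signedPow c ((y : Fin 3 → ℝ) i)))
      (Eventually.of_forall fun y => hp _ (mem_cube fun i => by
        rw [abs_signedPow hc0]
        exact (abs_rpow_le_one_of_mem_cSphere hc0 y.2 i).trans one_le_two))
    simpa using h4
  rw [Real.dist_eq] at h1 ⊢
  rw [abs_le] at h2 h3
  rw [abs_lt] at h1 ⊢
  constructor <;> linarith [h1.1, h1.2, h2.1, h2.2, h3.1, h3.2]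

/-- The coordinatewise signed power has inverse `signedPow (1 / c)`, so `ψ` is pulled back to `Φ` in
the coordinates where the averages are known; uniform continuity of `Φ` absorbs the rounding. -/
lemma IsPolarMeasure.tendsto_sphereAvg (hc1 : 1 < c) (hc2 : c < 9 / 8)
    (h : IsPolarMeasure c μ) {ψ : (Fin 3 → ℝ) → ℝ} (hψ : Continuous ψ) :
    Tendsto (fun N : ℕ => sphereAvg hc1.le N fun x => ψ (fun i => (N : ℝ) ^ (-1 / c) * x i)) atTop
      (𝓝 (∫ y : cSphere c, ψ y ∂(normalized μ))) := by
  have hc0 : 0 < c := by linarith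
  set Φ : (Fin 3 → ℝ) → ℝ := fun u => ψ (fun i => signedPow (1 / c) (u i)) with hΦdef
  have hΦ : Continuous Φ := hψ.comp (continuous_pi fun i =>
    (continuous_signedPow (by positivity)).comp (continuous_apply i))
  have hΦψ : ∀ z : Fin 3 → ℝ, Φ (fun i => signedPow c (z i)) = ψ z := by
    intro z
    simp only [hΦdef, signedPow_signedPow hc0]
  have hmain := h.tendsto_sphereAvg_signedFloor hc1 hc2 hΦ
  simp only [hΦψ] at hmain
  have huc := isCompact_cube.uniformContinuousOn_of_continuous hΦ.continuousOn
  have hdiff : Tendsto (fun N : ℕ =>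
      (sphereAvg hc1.le N fun x => ψ (fun i => (N : ℝ) ^ (-1 / c) * x i))
      - sphereAvg hc1.le N fun x => Φ (fun i => signedFloor c (x i) / N)) atTop (𝓝 0) := by
    rw [Metric.tendsto_atTop]
    intro ε hε
    obtain ⟨δ, hδ, hδ'⟩ := Metric.uniformContinuousOn_iff.1 huc (ε / 2) (by positivity)
    obtain ⟨N₀, hN₀⟩ := exists_nat_gt (1 / δ)
    refine ⟨max N₀ 1, fun N hN => ?_⟩
    have hN1 : 0 < N := le_of_max_le_right hN
    have hNR : (0 : ℝ) < N := by exact_mod_cast hN1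
    have hNN : (N₀ : ℝ) ≤ N := by exact_mod_cast le_of_max_le_left hN
    have hNδ : 1 / (N : ℝ) < δ := by
      rw [div_lt_comm₀ hNR hδ]
      linarith
    have hN1' : 1 / (N : ℝ) ≤ 1 := by
      rw [div_le_one hNR]
      exact_mod_cast hN1
    rw [Real.dist_eq, sub_zero]
    refine lt_of_le_of_lt (abs_sphereAvg_sub_le hc1.le N (ε := ε / 2) (by positivity)
      fun x hx => ?_) (by linarith)
    rw [← hΦψ]
    have hclose := fun i => abs_signedPow_scaled_sub_le hc0 hN1 (x i)
    have hfl := fun i => abs_signedFloor_div_le hc1.le hN1 hx i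
    -- The images of the projected points may leave `[-1, 1]³` by `1/N ≤ 1`, whence the cube `[-2,
    -- 2]³`.
    refine (hδ' _ (mem_cube fun i => ?_) _ (mem_cube fun i => (hfl i).trans one_le_two) ?_).le
    · have h1 := abs_le.1 (hclose i)
      have h2 := abs_le.1 (hfl i)
      rw [abs_le]
      constructor <;> linarith [h1.1, h1.2, h2.1, h2.2]
    · rw [dist_pi_lt_iff hδ]
      exact fun i => (hclose i).trans_lt hNδ
  simpa using hdiff.add hmain

/-- For `N > 0` the scaling is injective, so summing over the image set counts each lattice point
once. -/
lemma finsum_projPoints (hc : 1 ≤ c) {N : ℕ} (hN : 0 < N) (φ : (Fin 3 → ℝ) → ℂ) :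
    ∑ᶠ x ∈ projPoints c N, φ x
      = ∑ x ∈ arithSphereFinset hc N, φ (fun i => (N : ℝ) ^ (-1 / c) * x i) := by
  have hNR : (0 : ℝ) < N := by exact_mod_cast hN
  have hinj : Function.Injective
      (fun x : Fin 3 → ℤ => fun i => (N : ℝ) ^ (-1 / c) * (x i : ℝ)) := by
    intro x y hxy
    ext i
    have h1 := congrFun hxy i
    exact_mod_cast mul_left_cancel₀ (Real.rpow_pos_of_pos hNR _).ne' h1
  rw [projPoints, finsum_mem_image hinj.injOn,
    finsum_mem_eq_finite_toFinset_sum _ (arithSphere_finite hc N)]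
  rfl

lemma IsPolarMeasure.tendsto_projPoints (hc1 : 1 < c) (hc2 : c < 9 / 8)
    (h : IsPolarMeasure c μ) {φ : (Fin 3 → ℝ) → ℂ} (hφ : Continuous φ) :
    Tendsto (fun N : ℕ => (1 / (latticeCount c N : ℂ)) * ∑ᶠ x ∈ projPoints c N, φ x)
      atTop (𝓝 (∫ y : cSphere c, φ y ∂(normalized μ))) := by
  have hc0 : 0 < c := by linarith
  have := h.isProbabilityMeasure_normalized hc0
  have hint : Integrable (fun y : cSphere c => φ y) (normalized μ) :=
    integrable_of_continuous hc0 _ (hφ.comp continuous_subtype_val)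
  have hre := h.tendsto_sphereAvg hc1 hc2 (Complex.continuous_re.comp hφ)
  have him := h.tendsto_sphereAvg hc1 hc2 (Complex.continuous_im.comp hφ)
  have hC := ((Complex.continuous_ofReal.tendsto _).comp hre).add
    (((Complex.continuous_ofReal.tendsto _).comp him).mul_const Complex.I)
  have hI : ((∫ y : cSphere c, (φ y).re ∂(normalized μ) : ℝ) : ℂ)
      + ((∫ y : cSphere c, (φ y).im ∂(normalized μ) : ℝ) : ℂ) * Complex.I
      = ∫ y : cSphere c, φ y ∂(normalized μ) := integral_re_add_im hint
  simp only [Function.comp_apply] at hC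
  rw [hI] at hC
  refine hC.congr' ?_
  filter_upwards [eventually_gt_atTop 0] with N hN
  rw [finsum_projPoints hc1.le hN]
  simp only [sphereAvg]
  push_cast
  rw [mul_assoc, ← mul_add, one_div, Finset.sum_mul, ← Finset.sum_add_distrib]
  congr 1
  exact Finset.sum_congr rfl fun x _ => Complex.re_add_im _

end Equidistribution

theorem theorem1p9 (c : ℝ) (hc1 : 1 < c) (hc2 : c < 9 / 8) :
    ∃ μ : Measure (cSphere c),
      -- `μ` is the unique polar decomposition measure on the sphere
      IsPolarMeasure c μ ∧ (∀ μ' : Measure (cSphere c), IsPolarMeasure c μ' → μ' = μ) ∧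
      -- its total mass
      μ univ = ENNReal.ofReal (8 * Real.Gamma (1 / c) ^ 3 / (c ^ 2 * Real.Gamma (3 / c))) ∧
      -- its normalization is a probability measure
      IsProbabilityMeasure (normalized μ) ∧
      -- equidistribution
      ∀ φ : (Fin 3 → ℝ) → ℂ, ContDiff ℝ ∞ φ →
        Integrable (fun y : cSphere c => φ y) (normalized μ) ∧
        Tendsto (fun N : ℕ => (1 / (latticeCount c N : ℂ)) * ∑ᶠ x ∈ projPoints c N, φ x)
          atTop (𝓝 (∫ y : cSphere c, φ y ∂(normalized μ))) := by
  have hc0 : 0 < c := by linarith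
  obtain ⟨μ, h⟩ := exists_isPolarMeasure hc1.le
  have hprob := h.isProbabilityMeasure_normalized hc0
  refine ⟨μ, h, fun μ' h' => h'.unique hc0 h, ?_, hprob, fun φ hφ =>
    ⟨integrable_of_continuous hc0 _ (hφ.continuous.comp continuous_subtype_val),
      h.tendsto_projPoints hc1 hc2 hφ.continuous⟩⟩
  rw [h.measure_univ hc0, polarMoment]
  congr 1
  simp only [Pi.zero_apply, Nat.cast_zero, add_zero]
  rw [show 3 * (1 / c) = 3 / c by ring]
  field_simp
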